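/- Let $\Omega\subseteq\mathbb C^m$ be bounded, open and connected, and let $\mathcal A(\Omega)$ be the completion, in the supremum norm on $\overline\Omega$, of the algebra of functions holomorphic in a neighbourhood of $\overline\Omega$. Let $\mathcal Z\subseteq\Omega$ be a connected smooth complex hypersurface: near each of its points it is the zero set of a holomorphic function $\varphi$ with $d\varphi\neq0$ on $\mathcal Z$. Let $\mathcal M$ and $\tilde{\mathcal M}$ be quasi-free Hilbert modules of rank $1$ over $\mathcal A(\Omega)$. That is, each is a Hilbert space completion of $\mathcal A(\Omega)$ for which (1) the evaluations at points of $\Omega$ are locally uniformly bounded, (2) multiplication by each $f\in\mathcal A(\Omega)$ is bounded, and (3) a sequence in $\mathcal A(\Omega)$ that is Cauchy in the norm of the module converges to $0$ in norm if and only if it converges to $0$ at every point of $\Omega$. The elements of such a module are holomorphic functions on $\Omega$. Let $K,\tilde K$ be the reproducing kernels, and write $h(z)=K(z,z)$, $\tilde h(z)=\tilde K(z,z)$ for the hermitian metrics of the associated line bundles $E,\tilde E$. Let $\mathcal M_0\subseteq\mathcal M$ be the submodule of the functions vanishing to order $2$ on $\mathcal Z$ (that is, locally of the form $\varphi^2g$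 with $g$ holomorphic), and let $\mathcal Q=\mathcal M\ominus\mathcal M_0$ with the compressed module action $f\cdot(x+\mathcal M_0)=fx+\mathcal M_0$. Define $\tilde{\mathcal Q}=\tilde{\mathcal M}\ominus\tilde{\mathcal M}_0$ likewise. Near each $p\in\mathcal Z$ fix a normal direction: a holomorphic vector field $\nu$ near $p$ with $\nu(p)\notin T_p\mathcal Z$ (for example $\partial/\partial z_1$ if $\mathcal Z=\{z_1=0\}$). Write $\mathcal K(u,v)=\bar\partial_u(h^{-1}\partial_v h)$ for the coefficients of the curvature $\mathcal K=\bar\partial(h^{-1}\partial h)$. At $p\in\mathcal Z$ define the tangential curvature $\mathcal K_{\rm tan}=\mathcal K|_{T_p\mathcal Z\times T_p\mathcal Z}$, the transverse curvature $\mathcal K_{\rm trans}=\mathcal K(\nu,\nu)$, and the off-diagonal coefficients $\mathcal S=\mathcal K(\nu,\cdot)|_{T_p\mathcal Z}$. Further, let $J^{(2)}E$ be the jet bundle with holomorphic frame $(s,\partial_\nu s)$, where $s$ is a holomorphic frame of $E$ with $\langle s,s\rangle=h$, and with metric $$\begin{pmatrix}h&\partial_\nu h\\ \bar\partial_\nu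 h&\bar\partial_\nu\partial_\nu h\end{pmatrix}.$$ Let $D$ be its canonical (Chern) connection and $(e_1,e_2)$ the orthonormal frame obtained from $(s,\partial_\nu s)$ by the Gram–Schmidt process. The second fundamental form of the inclusion $E\subseteq J^{(2)}E$ is the one-form $\mathbb I=\langle De_2,e_1\rangle$. Define $\tilde{\mathcal K}_{\rm tan},\tilde{\mathcal K}_{\rm trans},\tilde{\mathcal S},\tilde{\mathbb I}$ in the same way from $\tilde h$, with the same $\nu$. Then $\mathcal Q$ and $\tilde{\mathcal Q}$ are isomorphic (there is a unitary module map between them) if and only if $$\mathcal K_{\rm tan}=\tilde{\mathcal K}_{\rm tan},\qquad \mathcal K_{\rm trans}=\tilde{\mathcal K}_{\rm trans},\qquad \mathcal S=\tilde{\mathcal S}\qquad\text{on }\mathcal Z.$$ Equivalently, they are isomorphic if and only if $\mathcal K_{\rm tan}=\tilde{\mathcal K}_{\rm tan}$, $\mathcal K_{\rm trans}=\tilde{\mathcal K}_{\rm trans}$ and $\mathbb I=\tilde{\mathbb I}$ on $\mathcal Z$. -/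

import Mathlib

open Set Filter Topology

noncomputable section

/-! ### Function algebra -/

/-- Functions on `closure Ω` that are restrictions of functions holomorphic (locally given by
convergent power series) in a neighbourhood of `closure Ω`. -/
def holoNearClosure {m : ℕ} (Ω : Set (EuclideanSpace ℂ (Fin m))) :
    Subalgebra ℂ C(closure Ω, ℂ) where
  carrier := {f | ∃ (U : Set (EuclideanSpace ℂ (Fin m))) (F : EuclideanSpace ℂ (Fin m) → ℂ),
    IsOpen U ∧ closure Ω ⊆ U ∧ AnalyticOnNhd ℂ F U ∧ ∀ w : closure Ω, f w = F w}
  mul_mem' := by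
    rintro f g ⟨U, F, hU, hΩU, hF, hfF⟩ ⟨V, G, hV, hΩV, hG, hgG⟩
    refine ⟨U ∩ V, F * G, hU.inter hV, subset_inter hΩU hΩV,
      (hF.mono inter_subset_left).mul (hG.mono inter_subset_right), fun w => ?_⟩
    simp [hfF, hgG]
  add_mem' := by
    rintro f g ⟨U, F, hU, hΩU, hF, hfF⟩ ⟨V, G, hV, hΩV, hG, hgG⟩
    refine ⟨U ∩ V, F + G, hU.inter hV, subset_inter hΩU hΩV,
      (hF.mono inter_subset_left).add (hG.mono inter_subset_right), fun w => ?_⟩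
    simp [hfF, hgG]
  algebraMap_mem' := by
    intro c
    exact ⟨univ, fun _ => c, isOpen_univ, subset_univ _, analyticOnNhd_const, fun w => rfl⟩

instance {m : ℕ} (Ω : Set (EuclideanSpace ℂ (Fin m))) : LocallyCompactSpace (closure Ω) :=
  isClosed_closure.isClosedEmbedding_subtypeVal.locallyCompactSpace

/-- The algebra `𝒜(Ω)`: the closure, in the continuous functions on `closure Ω`, of the functions
holomorphic in a neighbourhood of `closure Ω`. (For bounded `Ω` the set `closure Ω` is compact and
the topology of `C(closure Ω, ℂ)` is that of the supremum norm.) -/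
def AlgA {m : ℕ} (Ω : Set (EuclideanSpace ℂ (Fin m))) : Type :=
  (holoNearClosure Ω).topologicalClosure

instance {m : ℕ} (Ω : Set (EuclideanSpace ℂ (Fin m))) : CommRing (AlgA Ω) :=
  inferInstanceAs (CommRing (holoNearClosure Ω).topologicalClosure)

instance {m : ℕ} (Ω : Set (EuclideanSpace ℂ (Fin m))) : Algebra ℂ (AlgA Ω) :=
  inferInstanceAs (Algebra ℂ (holoNearClosure Ω).topologicalClosure)

/-- Evaluation of `f ∈ 𝒜(Ω)` at a point `w` (with value `0` off `closure Ω`). -/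
def evalA {m : ℕ} (Ω : Set (EuclideanSpace ℂ (Fin m))) (w : EuclideanSpace ℂ (Fin m)) :
    AlgA Ω →ₗ[ℂ] ℂ :=
  open Classical in
  if hw : w ∈ closure Ω then
    { toFun := fun f => f.1 ⟨w, hw⟩
      map_add' := fun _ _ => rfl
      map_smul' := fun _ _ => rfl }
  else 0

/-! ### Quasi-free Hilbert modules of rank one -/

/-- A Hilbert space `H` presented as a quasi-free Hilbert module of rank one over `𝒜(Ω)`: it is a
completion of `𝒜(Ω)` (via the injection `emb` with dense range) such that evaluations at the points
of `Ω` are locally uniformly bounded, multiplications by elements of `𝒜(Ω)` are bounded, and a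
sequence in `𝒜(Ω)` that is Cauchy in `H` converges to `0` in `H` iff it does so pointwise on `Ω`. -/
structure QuasiFree {m : ℕ} (Ω : Set (EuclideanSpace ℂ (Fin m)))
    (H : Type*) [NormedAddCommGroup H] [InnerProductSpace ℂ H] [CompleteSpace H] where
  emb : AlgA Ω →ₗ[ℂ] H
  emb_injective : Function.Injective emb
  emb_dense : DenseRange emb
  eval_bounded : ∀ w ∈ Ω, ∃ V ∈ 𝓝 w, ∃ C : ℝ, ∀ z ∈ V ∩ Ω, ∀ f : AlgA Ω,
    ‖evalA Ω z f‖ ≤ C * ‖emb f‖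
  mul_bounded : ∀ f : AlgA Ω, ∃ C : ℝ, ∀ g : AlgA Ω, ‖emb (f * g)‖ ≤ C * ‖emb g‖
  tendsto_zero_iff : ∀ f : ℕ → AlgA Ω, CauchySeq (fun n => emb (f n)) →
    (Tendsto (fun n => emb (f n)) atTop (𝓝 0) ↔
      ∀ w ∈ Ω, Tendsto (fun n => evalA Ω w (f n)) atTop (𝓝 0))

namespace QuasiFree

variable {m : ℕ} {Ω : Set (EuclideanSpace ℂ (Fin m))}
  {H : Type*} [NormedAddCommGroup H] [InnerProductSpace ℂ H] [CompleteSpace H]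

/-- The bounded extension to `H` of the evaluation at `w ∈ Ω`; an element `x` of `H` is thereby the
function `w ↦ M.eval w x` on `Ω`. -/
def eval (M : QuasiFree Ω H) (w : EuclideanSpace ℂ (Fin m)) : H →L[ℂ] ℂ :=
  LinearMap.extendOfNorm (evalA Ω w) M.emb

theorem eval_emb (M : QuasiFree Ω H) {w : EuclideanSpace ℂ (Fin m)} (hw : w ∈ Ω) (f : AlgA Ω) :
    M.eval w (M.emb f) = evalA Ω w f := by
  obtain ⟨V, hV, C, hC⟩ := M.eval_bounded w hw
  exact LinearMap.extendOfNorm_eq M.emb_dense ⟨C, hC w ⟨mem_of_mem_nhds hV, hw⟩⟩ f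

/-- The module action: the bounded extension to `H` of the multiplication by `f` on `𝒜(Ω)`. -/
def act (M : QuasiFree Ω H) (f : AlgA Ω) : H →L[ℂ] H :=
  LinearMap.extendOfNorm (M.emb ∘ₗ LinearMap.mulLeft ℂ f) M.emb

theorem act_emb (M : QuasiFree Ω H) (f g : AlgA Ω) : M.act f (M.emb g) = M.emb (f * g) :=
  LinearMap.extendOfNorm_eq M.emb_dense (M.mul_bounded f) g

/-- The reproducing kernel `K(z, w) = e_z e_w^*`. -/
def kernel (M : QuasiFree Ω H) (z w : EuclideanSpace ℂ (Fin m)) : ℂ :=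
  M.eval z (ContinuousLinearMap.adjoint (M.eval w) 1)

/-- The hermitian metric `ϱ(w) = K(w, w)` of the line bundle of `M`, in its canonical frame. -/
def metric (M : QuasiFree Ω H) (w : EuclideanSpace ℂ (Fin m)) : ℂ := M.kernel w w

end QuasiFree

/-! ### Hypersurfaces, order of vanishing, quotient modules -/

/-- `φ` is a defining function of `Z` on the open set `U ⊆ Ω`: it is holomorphic on `U`, its zero
set in `U` is `U ∩ Z`, and its differential does not vanish at the points of `U ∩ Z`. -/
structure IsDefiningFunction {m : ℕ} (Ω Z : Set (EuclideanSpace ℂ (Fin m)))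
    (U : Set (EuclideanSpace ℂ (Fin m))) (φ : EuclideanSpace ℂ (Fin m) → ℂ) : Prop where
  isOpen : IsOpen U
  subset : U ⊆ Ω
  holo : AnalyticOnNhd ℂ φ U
  zero_iff : ∀ z ∈ U, φ z = 0 ↔ z ∈ Z
  fderiv_ne_zero : ∀ z ∈ U ∩ Z, fderiv ℂ φ z ≠ 0

/-- `Z ⊆ Ω` is a (smooth, complex) hypersurface. -/
def IsHypersurface {m : ℕ} (Ω Z : Set (EuclideanSpace ℂ (Fin m))) : Prop :=
  Z ⊆ Ω ∧ ∀ p ∈ Z, ∃ U φ, IsDefiningFunction Ω Z U φ ∧ p ∈ U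

/-- The holomorphic tangent space `T_p Z`, the kernel of `dφ_p` for the local defining functions
`φ` of `Z` at `p`. -/
def tangentZ {m : ℕ} (Ω Z : Set (EuclideanSpace ℂ (Fin m))) (p : EuclideanSpace ℂ (Fin m)) :
    Submodule ℂ (EuclideanSpace ℂ (Fin m)) where
  carrier := {v | ∀ U φ, IsDefiningFunction Ω Z U φ → p ∈ U → fderiv ℂ φ p v = 0}
  add_mem' := by
    intro a b ha hb U φ h hp
    rw [map_add, ha U φ h hp, hb U φ h hp, add_zero]
  zero_mem' := by
    intro U φ _ _
    exact map_zero _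
  smul_mem' := by
    intro c a ha U φ h hp
    rw [map_smul, ha U φ h hp, smul_zero]

namespace QuasiFree

variable {m : ℕ} {Ω : Set (EuclideanSpace ℂ (Fin m))}
  {H : Type*} [NormedAddCommGroup H] [InnerProductSpace ℂ H] [CompleteSpace H]

/-- `ℳ₀`: the elements of `M` that, as functions on `Ω`, vanish to order `k` on `Z`, i.e. are of the
form `φ ^ k * g` with `g` holomorphic, for the local defining functions `φ` of `Z`. -/
def vanishing (M : QuasiFree Ω H) (Z : Set (EuclideanSpace ℂ (Fin m))) (k : ℕ) :
    Submodule ℂ H where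
  carrier := {x | ∀ U φ, IsDefiningFunction Ω Z U φ →
    ∃ g : EuclideanSpace ℂ (Fin m) → ℂ, AnalyticOnNhd ℂ g U ∧
      ∀ z ∈ U, M.eval z x = φ z ^ k * g z}
  add_mem' := by
    intro a b ha hb U φ h
    obtain ⟨g, hg, hg'⟩ := ha U φ h
    obtain ⟨g₂, hg₂, hg₂'⟩ := hb U φ h
    exact ⟨g + g₂, hg.add hg₂, fun z hz => by
      rw [map_add, hg' z hz, hg₂' z hz, Pi.add_apply, mul_add]⟩
  zero_mem' := by
    intro U φ _
    exact ⟨0, analyticOnNhd_const, fun z _ => by simp⟩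
  smul_mem' := by
    intro c a ha U φ h
    obtain ⟨g, hg, hg'⟩ := ha U φ h
    exact ⟨fun z => c * g z, analyticOnNhd_const.mul hg, fun z hz => by
      rw [map_smul, hg' z hz, smul_eq_mul, mul_left_comm]⟩

/-- The quotient module `𝒬 = ℳ ⊖ ℳ₀`, for the functions vanishing to order `2` on `Z`. -/
abbrev quot (M : QuasiFree Ω H) (Z : Set (EuclideanSpace ℂ (Fin m))) : Submodule ℂ H :=
  (M.vanishing Z 2)ᗮ

/-- The module action on `ℳ ⊖ ℳ₀`, i.e. `f · (x + ℳ₀) = f · x + ℳ₀`: the compression of the action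
on `ℳ`. -/
def quotAct (M : QuasiFree Ω H) (Z : Set (EuclideanSpace ℂ (Fin m))) (f : AlgA Ω) :
    M.quot Z →L[ℂ] M.quot Z :=
  (M.quot Z).orthogonalProjectionOnto ∘L M.act f ∘L (M.quot Z).subtypeL

/-- Isomorphism of the quotient Hilbert modules: a unitary module map. -/
def QuotIso {H' : Type*} [NormedAddCommGroup H'] [InnerProductSpace ℂ H'] [CompleteSpace H']
    (M : QuasiFree Ω H) (M' : QuasiFree Ω H') (Z : Set (EuclideanSpace ℂ (Fin m))) : Prop :=
  ∃ T : M.quot Z ≃ₗᵢ[ℂ] M'.quot Z,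
    ∀ (f : AlgA Ω) (x : M.quot Z), T (M.quotAct Z f x) = M'.quotAct Z f (T x)

end QuasiFree

/-! ### Hermitian geometry -/

/-- The `(1,0)` derivative `∂_v f = (df(v) - i df(iv)) / 2`; for `v` the `j`-th unit vector it is
`∂f/∂z_j`. -/
def dHol {E F : Type*} [NormedAddCommGroup E] [NormedSpace ℂ E] [NormedAddCommGroup F]
    [NormedSpace ℂ F] (f : E → F) (z v : E) : F :=
  (2⁻¹ : ℂ) • (fderiv ℝ f z v - Complex.I • fderiv ℝ f z (Complex.I • v))

/-- The `(0,1)` derivative `∂̄_v f = (df(v) + i df(iv)) / 2`; for `v` the `j`-th unit vector it is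
`∂f/∂z̄_j`. -/
def dBar {E F : Type*} [NormedAddCommGroup E] [NormedSpace ℂ E] [NormedAddCommGroup F]
    [NormedSpace ℂ F] (f : E → F) (z v : E) : F :=
  (2⁻¹ : ℂ) • (fderiv ℝ f z v + Complex.I • fderiv ℝ f z (Complex.I • v))

/-- The curvature `𝒦 = ∂̄ (h⁻¹ ∂ h)` of a hermitian holomorphic line bundle with metric `h` in a
holomorphic frame: `curvature h z u v` is the coefficient `∂̄_u (h⁻¹ ∂_v h)`, which is `𝒦_ij` (the
coefficient of `dz̄_i ∧ dz_j`) when `u`, `v` are the `i`-th and `j`-th unit vectors. -/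
def curvature {m : ℕ} (h : EuclideanSpace ℂ (Fin m) → ℂ) (z u v : EuclideanSpace ℂ (Fin m)) : ℂ :=
  dBar (fun w => (h w)⁻¹ * dHol h w v) z u

/-- Tangential curvature at `p ∈ Z`. -/
def curvTan {m : ℕ} (Ω Z : Set (EuclideanSpace ℂ (Fin m))) (h : EuclideanSpace ℂ (Fin m) → ℂ)
    (p : EuclideanSpace ℂ (Fin m)) : tangentZ Ω Z p → tangentZ Ω Z p → ℂ :=
  fun u v => curvature h p u v

/-- Transverse curvature at `p`, for the normal direction `n`. -/
def curvTrans {m : ℕ} (h : EuclideanSpace ℂ (Fin m) → ℂ) (p n : EuclideanSpace ℂ (Fin m)) : ℂ :=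
  curvature h p n n

/-- The off-diagonal curvature coefficients `𝒮` (`𝒦_1j` with `j ≥ 2`, if `n` is the first and the
other unit vectors are tangent to `Z`) at `p ∈ Z`, for the normal direction `n`. -/
def curvOff {m : ℕ} (Ω Z : Set (EuclideanSpace ℂ (Fin m))) (h : EuclideanSpace ℂ (Fin m) → ℂ)
    (p n : EuclideanSpace ℂ (Fin m)) : tangentZ Ω Z p → ℂ :=
  fun v => curvature h p n v

/-- The metric of the second order jet bundle `J^(2) E` in the holomorphic frame `(s, ∂_ν s)`, where
`ν` is a holomorphic vector field and `h = ⟨s, s⟩`. The `(i, j)` entry is `⟨s_j, s_i⟩`. -/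
def jetMetric {m : ℕ} (ν : EuclideanSpace ℂ (Fin m) → EuclideanSpace ℂ (Fin m))
    (h : EuclideanSpace ℂ (Fin m) → ℂ) (z : EuclideanSpace ℂ (Fin m)) : Matrix (Fin 2) (Fin 2) ℂ :=
  !![h z, dHol h z (ν z);
     dBar h z (ν z), dBar (fun w => dHol h w (ν w)) z (ν z)]

/-- The hermitian inner product `⟨a, b⟩` (linear in `a`) of two vectors with coefficients `a`, `b`
in a frame `s` whose Gram matrix `(⟨s_j, s_i⟩)_ij` is `N`. -/
def fiberInner (N : Matrix (Fin 2) (Fin 2) ℂ) (a b : Fin 2 → ℂ) : ℂ :=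
  star b ⬝ᵥ N.mulVec a

/-- The norm of the vector with coefficients `a`. -/
def fiberNorm (N : Matrix (Fin 2) (Fin 2) ℂ) (a : Fin 2 → ℂ) : ℝ :=
  Real.sqrt (fiberInner N a a).re

/-- First and second vector of the orthonormal frame which the Gram-Schmidt process yields from the
frame `s`. -/
def gramSchmidt₁ (N : Matrix (Fin 2) (Fin 2) ℂ) : Fin 2 → ℂ :=
  ((fiberNorm N ![1, 0])⁻¹ : ℂ) • ![1, 0]

/-- See `gramSchmidt₁`. -/
def gramSchmidt₂ (N : Matrix (Fin 2) (Fin 2) ℂ) : Fin 2 → ℂ :=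
  let x : Fin 2 → ℂ := ![0, 1] - fiberInner N ![0, 1] (gramSchmidt₁ N) • gramSchmidt₁ N
  ((fiberNorm N x)⁻¹ : ℂ) • x

/-- The canonical connection `D = D^{1,0} + D^{0,1}` of a hermitian holomorphic bundle of rank two
with Gram matrix `N` in a holomorphic frame, evaluated at the real tangent vector `v`:
`D^{1,0} σ = ∂σ + N⁻¹ (∂N) σ` and `D^{0,1} σ = ∂̄σ`. -/
def chernD {m : ℕ} (N : EuclideanSpace ℂ (Fin m) → Matrix (Fin 2) (Fin 2) ℂ)
    (σ : EuclideanSpace ℂ (Fin m) → Fin 2 → ℂ) (z v : EuclideanSpace ℂ (Fin m)) : Fin 2 → ℂ :=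
  (dHol σ z v + ((N z)⁻¹ * Matrix.of fun i j => dHol (fun w => N w i j) z v).mulVec (σ z)) +
    dBar σ z v

/-- The second fundamental form `⟨D e₂, e₁⟩` of the inclusion `E ⊆ J^(2) E` (with respect to `ν`) at
`z`, a one-form on the (real) tangent space; `e₁`, `e₂` is the orthonormal frame obtained from
`s`, `∂_ν s`. -/
def secondFundamentalForm {m : ℕ} (ν : EuclideanSpace ℂ (Fin m) → EuclideanSpace ℂ (Fin m))
    (h : EuclideanSpace ℂ (Fin m) → ℂ) (z : EuclideanSpace ℂ (Fin m)) :
    EuclideanSpace ℂ (Fin m) → ℂ :=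
  fun v => fiberInner (jetMetric ν h z)
    (chernD (jetMetric ν h) (fun w => gramSchmidt₂ (jetMetric ν h w)) z v)
    (gramSchmidt₁ (jetMetric ν h z))

end

/-!
Let `e z` denote the evaluation at `z`, a functional on `ℳ`, so that the kernel is
`K (z, w) = ⟨e z, e w⟩` and the curvature is `∂̄∂ log K` on the diagonal. A function belongs to `ℳ₀`
if and only if it is annihilated by all the jets `s • e z + ∂_v e z` with `z ∈ 𝒵`. These functionals
are therefore total on the quotient module, an element of `𝒜(Ω)` acts on them through its own jet,
and, `𝒵` being connected, the jets along `𝒵` near a single point are already total.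

A unitary module map intertwines the two actions, so it matches the jets at `z` up to the jet of a
scalar function, and such a rescaling does not change `∂̄∂ log K`. Conversely, if the curvatures
agree along `𝒵`, then polarization gives `∂_z ∂̄_w log K = ∂_z ∂̄_w log K'` for `z` and `w` in `𝒵`
near a point `p`, normal directions included. After division of `e z` by the holomorphic function
`K (z, p)`, suitably normalized, integration from `p` makes the Gram matrices of the jets equal,
and equal Gram matrices give a unitary, which is a module map because the actions on jets agree.

Finally, the curvature is a hermitian form, and the second fundamental form is
`𝕀 v = -𝒦 (v, ν) / √𝒦 (ν, ν)`; so once the transverse curvature is known, `𝕀` and the row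
`𝒦 (ν, ·)` determine each other.
-/

section SeveralVariables

open MeasureTheory Metric

variable {F : Type*} [NormedAddCommGroup F] [NormedSpace ℂ F] {n : ℕ} {c w : Fin n → ℂ} {r : ℝ}

theorem continuous_torusMap (c : Fin n → ℂ) (R : Fin n → ℝ) : Continuous (torusMap c R) := by
  unfold torusMap; fun_prop

theorem torusMap_mem_closedBall (c : Fin n → ℂ) (hr : 0 ≤ r) (θ : Fin n → ℝ) :
    torusMap c (fun _ => r) θ ∈ closedBall c r := by
  rw [mem_closedBall, dist_pi_le_iff hr]
  intro i
  simp [torusMap, dist_eq_norm, abs_of_nonneg hr]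

theorem torusMap_apply_sub_ne_zero (hr : 0 < r) (hw : w ∈ ball c r) (θ : Fin n → ℝ) (i : Fin n) :
    torusMap c (fun _ => r) θ i - w i ≠ 0 := by
  intro h
  have hdist : dist (torusMap c (fun _ => r) θ i) (c i) = r := by
    simp [torusMap, dist_eq_norm, abs_of_nonneg hr.le]
  rw [mem_ball, dist_pi_lt_iff hr] at hw
  exact (hw i).ne (sub_eq_zero.mp h ▸ hdist)

theorem cons_mem_closedBall {c : Fin (n + 1) → ℂ} {x : ℂ} {y : Fin n → ℂ} (hr : 0 ≤ r)
    (hx : x ∈ closedBall (c 0) r) (hy : y ∈ closedBall (c ∘ Fin.succ) r) :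
    (Fin.cons x y : Fin (n + 1) → ℂ) ∈ closedBall c r := by
  rw [mem_closedBall, dist_pi_le_iff hr] at hy ⊢
  exact Fin.cases (by simpa using hx) fun j => by simpa using hy j

theorem update_mem_closedBall {z : Fin n → ℂ} {i : Fin n} {t : ℂ} (hr : 0 ≤ r)
    (hz : z ∈ closedBall c r) (ht : t ∈ closedBall (c i) r) :
    Function.update z i t ∈ closedBall c r := by
  rw [closedBall_pi _ hr] at hz ⊢
  exact update_mem_pi_iff.mpr ⟨fun j _ => hz j (mem_univ j), fun _ => ht⟩

theorem analyticAt_integral_smul {E K : Type*} [NormedAddCommGroup E] [NormedSpace ℂ E]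
    [TopologicalSpace K] [CompactSpace K] [MeasurableSpace K] [OpensMeasurableSpace K]
    {μ : Measure K} [IsFiniteMeasure μ] {h : K → F} (hh : Continuous h) {A : E → C(K, ℂ)} {c : E}
    (hA : AnalyticAt ℂ A c) : AnalyticAt ℂ (fun w => ∫ θ, A w θ • h θ ∂μ) c := by
  have hcont : ∀ {G : Type _} [NormedAddCommGroup G] {k : K → G}, Continuous k → Integrable k μ :=
    fun hk => hk.integrable_of_hasCompactSupport (HasCompactSupport.of_compactSpace _)
  have hsmul : ∀ g : C(K, ℂ), Integrable (fun θ => g θ • h θ) μ := fun g =>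
    hcont (g.continuous.smul hh)
  let L : C(K, ℂ) →L[ℂ] F := LinearMap.mkContinuous
    { toFun := fun g => ∫ θ, g θ • h θ ∂μ
      map_add' := fun a b => by
        simp only [ContinuousMap.add_apply, add_smul]
        exact integral_add (hsmul a) (hsmul b)
      map_smul' := fun a b => by
        simp only [ContinuousMap.smul_apply, smul_assoc]
        exact integral_smul a _ }
    (∫ θ, ‖h θ‖ ∂μ) (fun g => by
      refine (norm_integral_le_integral_norm _).trans ?_
      rw [mul_comm, ← integral_const_mul]
      refine integral_mono (hsmul g).norm ((hcont hh).norm.const_mul _) fun θ => ?_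
      simp only [norm_smul]
      exact mul_le_mul_of_nonneg_right (g.norm_coe_le_norm θ) (norm_nonneg _))
  exact (L.analyticAt (A c)).comp hA

theorem analyticAt_prod_ringInverse_sub {R : Type*} [NormedCommRing R] [NormedAlgebra ℂ R]
    [CompleteSpace R] {a : Fin n → R} (ha : ∀ i, IsUnit (a i - algebraMap ℂ R (c i))) :
    AnalyticAt ℂ (fun w : Fin n → ℂ => ∏ i, Ring.inverse (a i - algebraMap ℂ R (w i))) c := by
  refine Finset.analyticAt_fun_prod _ fun i _ => ?_
  refine AnalyticAt.comp (g := Ring.inverse)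
    (f := fun w : Fin n → ℂ => a i - algebraMap ℂ R (w i)) ?_ ?_
  · obtain ⟨u, hu⟩ := ha i
    simpa only [hu] using analyticAt_inverse (𝕜 := ℂ) u
  · exact analyticAt_const.sub (((Algebra.linearMap ℂ R).toContinuousLinearMap ∘L
      (ContinuousLinearMap.proj (R := ℂ) (φ := fun _ : Fin n => ℂ) i)).analyticAt c)

-- The Cauchy kernel is analytic as a map into the Banach algebra of continuous functions on the
-- parameter cube, where it is a product of ring inverses.
theorem analyticAt_torusIntegral_prod_inv_smul (hr : 0 < r) {f : (Fin n → ℂ) → F}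
    (hf : ContinuousOn f (closedBall c r)) :
    AnalyticAt ℂ (fun w => ∯ ζ in T(c, fun _ => r), (∏ i, (ζ i - w i)⁻¹) • f ζ) c := by
  set K : Set (Fin n → ℝ) := Icc (0 : Fin n → ℝ) fun _ => 2 * Real.pi
  have hK : IsCompact K := isCompact_Icc
  have : CompactSpace K := isCompact_iff_compactSpace.mp hK
  let μ : Measure K := Measure.comap Subtype.val volume
  have : IsFiniteMeasure μ := ⟨by
    rw [(MeasurableEmbedding.subtype_coe hK.measurableSet).comap_apply, image_univ,
      Subtype.range_coe]
    exact hK.measure_lt_top⟩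
  let h : K → F := fun θ => (∏ i : Fin n, (r : ℂ) * Complex.exp (θ.1 i * Complex.I) * Complex.I) •
    f (torusMap c (fun _ => r) θ)
  have hh : Continuous h := by
    refine Continuous.smul ((by fun_prop : Continuous fun θ : Fin n → ℝ =>
      ∏ i : Fin n, (r : ℂ) * Complex.exp (θ i * Complex.I) * Complex.I).comp
        continuous_subtype_val) ?_
    exact hf.comp_continuous ((continuous_torusMap _ _).comp continuous_subtype_val)
      fun θ => torusMap_mem_closedBall c hr.le θ
  let ζ : Fin n → C(K, ℂ) := fun i => ⟨fun θ => torusMap c (fun _ => r) θ i,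
    (continuous_apply i).comp ((continuous_torusMap c fun _ => r).comp continuous_subtype_val)⟩
  have hunit : ∀ w ∈ ball c r, ∀ i, IsUnit (ζ i - algebraMap ℂ C(K, ℂ) (w i)) := fun w hw i =>
    ContinuousMap.isUnit_iff_forall_ne_zero _ |>.mpr
      fun θ => torusMap_apply_sub_ne_zero hr hw θ.1 i
  refine (analyticAt_integral_smul (μ := μ) hh
    (analyticAt_prod_ringInverse_sub (hunit c (mem_ball_self hr)))).congr ?_
  filter_upwards [ball_mem_nhds c hr] with w hw
  have hkernel : ∀ θ : K, (∏ i, Ring.inverse (ζ i - algebraMap ℂ C(K, ℂ) (w i))) θ =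
      ∏ i, (torusMap c (fun _ => r) θ i - w i)⁻¹ := fun θ => by
    rw [ContinuousMap.prod_apply]
    refine Finset.prod_congr rfl fun i _ => eq_inv_of_mul_eq_one_left ?_
    exact congrArg (fun g : C(K, ℂ) => g θ) (Ring.inverse_mul_cancel _ (hunit w hw i))
  rw [torusIntegral, ← integral_subtype_comap hK.measurableSet]
  refine integral_congr_ae (Eventually.of_forall fun θ => ?_)
  simp only [hkernel, h]
  rw [smul_comm]

theorem torusIntegrable_prod_inv_smul (hr : 0 < r) {f : (Fin n → ℂ) → F}
    (hf : ContinuousOn f (closedBall c r)) (hw : w ∈ ball c r) :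
    TorusIntegrable (fun ζ => (∏ i, (ζ i - w i)⁻¹) • f ζ) c (fun _ => r) := by
  refine ContinuousOn.integrableOn_compact isCompact_Icc (Continuous.continuousOn ?_)
  refine Continuous.smul (continuous_finsetProd _ fun i _ => Continuous.inv₀ ?_ fun θ =>
    torusMap_apply_sub_ne_zero hr hw θ i) ?_
  · exact ((continuous_apply i).comp (continuous_torusMap c fun _ => r)).sub
      (continuous_const (y := w i))
  · exact hf.comp_continuous (continuous_torusMap _ _) fun θ => torusMap_mem_closedBall c hr.le θ

section CauchyFormula

theorem differentiableAt_comp_update {f : (Fin n → ℂ) → F} {z : Fin n → ℂ} {i : Fin n} {t : ℂ}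
    (h : DifferentiableAt ℂ (fun s : ℂ => f (Function.update z i t + s • Pi.single i 1)) 0) :
    DifferentiableAt ℂ (fun s => f (Function.update z i s)) t := by
  have hline : ∀ s, Function.update z i s = Function.update z i t + (s - t) • Pi.single i 1 := by
    intro s
    ext j
    rcases eq_or_ne j i with rfl | hj
    · simp
    · simp [hj]
  rw [show (fun s => f (Function.update z i s)) =
      (fun s => f (Function.update z i t + s • Pi.single i 1)) ∘ fun s => s - t from
    funext fun s => congrArg f (hline s)]
  exact DifferentiableAt.comp t (by simpa only [sub_self] using h) (by fun_prop)

variable [CompleteSpace F]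

theorem torusIntegral_prod_inv_smul (hr : 0 < r) {f : (Fin n → ℂ) → F}
    (hf : ContinuousOn f (closedBall c r))
    (hd : ∀ z ∈ closedBall c r, ∀ i,
      DifferentiableOn ℂ (fun t => f (Function.update z i t)) (ball (c i) r))
    (hw : w ∈ ball c r) :
    (∯ ζ in T(c, fun _ => r), (∏ i, (ζ i - w i)⁻¹) • f ζ) =
      (2 * Real.pi * Complex.I : ℂ) ^ n • f w := by
  induction n with
  | zero => simp [Subsingleton.elim w c]
  | succ n ih =>
    have hcons := fun {x y} => cons_mem_closedBall (n := n) (c := c) (x := x) (y := y) hr.le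
    have hw0 : w 0 ∈ ball (c 0) r := (dist_pi_lt_iff hr).mp hw 0
    have hws : Fin.tail w ∈ ball (c ∘ Fin.succ) r :=
      (dist_pi_lt_iff hr).mpr fun i => (dist_pi_lt_iff hr).mp hw i.succ
    rw [torusIntegral_succ (torusIntegrable_prod_inv_smul hr hf hw)]
    have hinner : EqOn (fun x => ∯ y in T(c ∘ Fin.succ, (fun _ => r) ∘ Fin.succ),
        (∏ i, ((Fin.cons x y : Fin (n + 1) → ℂ) i - w i)⁻¹) • f (Fin.cons x y))
        (fun x => (x - w 0)⁻¹ • ((2 * Real.pi * Complex.I : ℂ) ^ n • f (Fin.cons x (Fin.tail w))))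
        (sphere (c 0) r) := by
      intro x hx
      have hx' := sphere_subset_closedBall hx
      have := ih (c := c ∘ Fin.succ) (f := fun y => f (Fin.cons x y))
        (hf.comp (Continuous.continuousOn (by fun_prop)) fun y hy => hcons hx' hy)
        (fun z hz i => by
          simp only [Fin.cons_update]
          exact hd _ (hcons hx' hz) i.succ) hws
      simp only [Fin.prod_univ_succ, Fin.cons_zero, Fin.cons_succ, mul_smul]
      rw [torusIntegral_smul]
      congr 1
    rw [circleIntegral.integral_congr hr.le hinner]
    have houter : DiffContOnCl ℂ (fun x => f (Fin.cons x (Fin.tail w))) (ball (c 0) r) := by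
      constructor
      · have := hd (Fin.cons (c 0) (Fin.tail w))
          (hcons (mem_closedBall_self hr.le) (ball_subset_closedBall hws)) 0
        simpa only [Fin.update_cons_zero] using this
      · rw [closure_ball _ hr.ne']
        exact hf.comp (Continuous.continuousOn (by fun_prop))
          fun x hx => hcons hx (ball_subset_closedBall hws)
    simp only [smul_comm _ ((2 * Real.pi * Complex.I : ℂ) ^ n)]
    rw [circleIntegral.integral_smul, houter.circleIntegral_sub_inv_smul hw0, smul_smul,
      ← pow_succ, Fin.cons_self_tail]

theorem analyticOnNhd_pi_of_continuousOn_of_line {U : Set (Fin n → ℂ)} (hU : IsOpen U)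
    {f : (Fin n → ℂ) → F} (hf : ContinuousOn f U)
    (hd : ∀ z ∈ U, ∀ v, DifferentiableAt ℂ (fun t : ℂ => f (z + t • v)) 0) :
    AnalyticOnNhd ℂ f U := by
  intro c hc
  obtain ⟨r, hr, hrU⟩ := nhds_basis_closedBall.mem_iff.mp (hU.mem_nhds hc)
  have hsep : ∀ z ∈ closedBall c r, ∀ i,
      DifferentiableOn ℂ (fun t => f (Function.update z i t)) (ball (c i) r) := fun z hz i t ht =>
    (differentiableAt_comp_update (hd _ (hrU (update_mem_closedBall hr.le hz
      (ball_subset_closedBall ht))) _)).differentiableWithinAt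
  have hpi : (2 * Real.pi * Complex.I : ℂ) ^ n ≠ 0 :=
    pow_ne_zero _ Complex.two_pi_I_ne_zero
  refine ((analyticAt_torusIntegral_prod_inv_smul hr (hf.mono hrU)).const_smul
    (c := ((2 * Real.pi * Complex.I : ℂ) ^ n)⁻¹)).congr ?_
  filter_upwards [ball_mem_nhds c hr] with w hw
  simp only [Pi.smul_apply]
  rw [torusIntegral_prod_inv_smul hr (hf.mono hrU) hsep hw, inv_smul_smul₀ hpi]

variable {E : Type*} [NormedAddCommGroup E] [NormedSpace ℂ E] [FiniteDimensional ℂ E] {U : Set E}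

/-- Osgood's lemma. -/
theorem analyticOnNhd_of_continuousOn_of_line (hU : IsOpen U) {f : E → F} (hf : ContinuousOn f U)
    (hd : ∀ z ∈ U, ∀ v, DifferentiableAt ℂ (fun t : ℂ => f (z + t • v)) 0) :
    AnalyticOnNhd ℂ f U := by
  let φ : E ≃L[ℂ] (Fin (Module.finrank ℂ E) → ℂ) := (Module.finBasis ℂ E).equivFunL
  have h := analyticOnNhd_pi_of_continuousOn_of_line (U := φ.symm ⁻¹' U) (f := f ∘ φ.symm)
    (hU.preimage φ.symm.continuous) (hf.comp φ.symm.continuous.continuousOn fun _ h => h)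
    (fun z hz v => by simpa using hd (φ.symm z) hz (φ.symm v))
  intro z hz
  have hφ : AnalyticAt ℂ ((f ∘ φ.symm) ∘ φ) z :=
    (h (φ z) (by simpa using hz)).comp (φ.toContinuousLinearMap.analyticAt z)
  exact hφ.congr (Eventually.of_forall fun w => by simp)

theorem analyticOnNhd_of_tendstoLocallyUniformlyOn {ι : Type*} {l : Filter ι} [l.NeBot]
    (hU : IsOpen U) {f : ι → E → F} {g : E → F} (h : TendstoLocallyUniformlyOn f g l U)
    (hf : ∀ i, AnalyticOnNhd ℂ (f i) U) : AnalyticOnNhd ℂ g U := by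
  refine analyticOnNhd_of_continuousOn_of_line hU
    (h.continuousOn (Eventually.of_forall fun i => (hf i).continuousOn).frequently) ?_
  intro z hz v
  let ℓ : ℂ → E := fun t => z + t • v
  have hℓ : Continuous ℓ := by fun_prop
  have hV : IsOpen (ℓ ⁻¹' U) := hU.preimage hℓ
  have hlim : TendstoLocallyUniformlyOn (fun i => f i ∘ ℓ) (g ∘ ℓ) l (ℓ ⁻¹' U) :=
    h.comp ℓ (fun _ h => h) hℓ.continuousOn
  refine (hlim.differentiableOn (Eventually.of_forall fun i => ?_) hV).differentiableAt
    (hV.mem_nhds (by simpa [ℓ] using hz))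
  exact (hf i).differentiableOn.comp (by fun_prop) fun _ h => h

end CauchyFormula

end SeveralVariables

section StrongHolomorphy

open Metric

variable {E X F : Type*} [NormedAddCommGroup E] [NormedSpace ℂ E] [NormedAddCommGroup X]
  [NormedSpace ℂ X] [NormedAddCommGroup F] [NormedSpace ℂ F]

-- Schwarz' lemma on the difference quotients of `z ↦ e z x`, uniformly in `‖x‖ ≤ 1`.
theorem continuousOn_clm_of_locally_bounded {U : Set E} (hU : IsOpen U) {e : E → X →L[ℂ] F}
    (he : ∀ x, DifferentiableOn ℂ (fun z => e z x) U)
    (hb : ∀ z ∈ U, ∃ V ∈ 𝓝 z, ∃ C : ℝ, ∀ w ∈ V, ‖e w‖ ≤ C) : ContinuousOn e U := by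
  refine fun z hz => ContinuousAt.continuousWithinAt ?_
  obtain ⟨V, hV, C, hC⟩ := hb z hz
  obtain ⟨R, hR, hRV⟩ := nhds_basis_ball.mem_iff.mp (inter_mem hV (hU.mem_nhds hz))
  have hC0 : 0 ≤ C := (norm_nonneg _).trans (hC z (hRV (mem_ball_self hR)).1)
  have hlip : ∀ w ∈ ball z R, dist (e w) (e z) ≤ 2 * C / R * dist w z := by
    intro w hw
    rw [dist_eq_norm]
    refine ContinuousLinearMap.opNorm_le_bound _ (by positivity) fun x => ?_
    have hmaps : MapsTo (fun z => e z x) (ball z R) (closedBall (e z x) (2 * C * ‖x‖)) := by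
      intro y hy
      rw [mem_closedBall, dist_eq_norm]
      have hy' := (e y).le_of_opNorm_le (hC y (hRV hy).1) x
      have hz' := (e z).le_of_opNorm_le (hC z (hRV (mem_ball_self hR)).1) x
      exact (norm_sub_le _ _).trans (by linarith)
    have hschwarz := Complex.dist_le_div_mul_dist_of_mapsTo_ball
      ((he x).mono (hRV.trans inter_subset_right)) hmaps hw
    rw [dist_eq_norm] at hschwarz
    exact hschwarz.trans (le_of_eq (by ring))
  rw [ContinuousAt, tendsto_iff_dist_tendsto_zero]
  have hlim : Tendsto (fun w => 2 * C / R * dist w z) (𝓝 z) (𝓝 0) := by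
    have : Continuous fun w => 2 * C / R * dist w z := by fun_prop
    simpa using this.tendsto z
  refine squeeze_zero' (Eventually.of_forall fun _ => dist_nonneg) ?_ hlim
  filter_upwards [ball_mem_nhds z hR] with w hw using hlip w hw

variable [CompleteSpace F]

-- The Cauchy integral of `e` is norm analytic, and it represents `e` because it does so pointwise.
theorem differentiableAt_clm_of_continuousOn {U : Set ℂ} (hU : IsOpen U) {e : ℂ → X →L[ℂ] F}
    (hc : ContinuousOn e U) (he : ∀ x, DifferentiableOn ℂ (fun z => e z x) U) {z : ℂ}
    (hz : z ∈ U) : DifferentiableAt ℂ e z := by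
  obtain ⟨r, hr, hrU⟩ := nhds_basis_closedBall.mem_iff.mp (hU.mem_nhds hz)
  lift r to NNReal using hr.le
  have hcs : ContinuousOn e (sphere z r) := hc.mono (sphere_subset_closedBall.trans hrU)
  refine ((hasFPowerSeriesOn_cauchy_integral (hcs.circleIntegrable hr.le)
    (by exact_mod_cast hr)).analyticAt.differentiableAt).congr_of_eventuallyEq ?_
  filter_upwards [ball_mem_nhds z hr] with w hw
  have hkernel : CircleIntegrable (fun ζ => (ζ - w)⁻¹ • e ζ) z r := by
    refine ContinuousOn.circleIntegrable hr.le (ContinuousOn.smul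
      (ContinuousOn.inv₀ (continuousOn_id.sub continuousOn_const) fun ζ hζ h => ?_) hcs)
    exact (mem_ball.mp hw).ne ((sub_eq_zero.mp h : ζ = w) ▸ mem_sphere.mp hζ)
  ext x
  have hcauchy : ((2 * Real.pi * Complex.I : ℂ)⁻¹ • ∮ ζ in C(z, r), (ζ - w)⁻¹ • e ζ x) = e w x :=
    ((he x).mono hrU).diffContOnCl_ball (subset_refl _)
      |>.two_pi_i_inv_smul_circleIntegral_sub_inv_smul hw
  have happly : (∮ ζ in C(z, r), (ζ - w)⁻¹ • e ζ) x = ∮ ζ in C(z, r), (ζ - w)⁻¹ • e ζ x := by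
    rw [circleIntegral, circleIntegral]
    simpa using ((ContinuousLinearMap.apply ℂ F x).intervalIntegral_comp_comm hkernel.out).symm
  rw [← hcauchy, _root_.smul_apply, happly]

theorem analyticOnNhd_clm_of_locally_bounded [FiniteDimensional ℂ E] {U : Set E} (hU : IsOpen U)
    {e : E → X →L[ℂ] F} (he : ∀ x, DifferentiableOn ℂ (fun z => e z x) U)
    (hb : ∀ z ∈ U, ∃ V ∈ 𝓝 z, ∃ C : ℝ, ∀ w ∈ V, ‖e w‖ ≤ C) : AnalyticOnNhd ℂ e U := by
  have hc := continuousOn_clm_of_locally_bounded hU he hb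
  refine analyticOnNhd_of_continuousOn_of_line hU hc fun z hz v => ?_
  have hℓ : Continuous fun t : ℂ => z + t • v := by fun_prop
  refine differentiableAt_clm_of_continuousOn (hU.preimage hℓ)
    (hc.comp hℓ.continuousOn fun _ h => h) (fun x => ?_) (by simpa using hz)
  exact (he x).comp (by fun_prop) fun _ h => h

end StrongHolomorphy

section FunctionAlgebra

variable {m : ℕ} {Ω : Set (EuclideanSpace ℂ (Fin m))} {w : EuclideanSpace ℂ (Fin m)}

theorem evalA_of_mem (hw : w ∈ closure Ω) (f : AlgA Ω) : evalA Ω w f = f.1 ⟨w, hw⟩ := by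
  rw [evalA, dif_pos hw]; rfl

theorem evalA_mul (hw : w ∈ closure Ω) (f g : AlgA Ω) :
    evalA Ω w (f * g) = evalA Ω w f * evalA Ω w g := by
  simp only [evalA_of_mem hw]; rfl

theorem evalA_one (hw : w ∈ closure Ω) : evalA Ω w (1 : AlgA Ω) = 1 := by
  simp only [evalA_of_mem hw]; rfl

theorem analyticOnNhd_evalA (f : AlgA Ω) :
    AnalyticOnNhd ℂ (fun w => evalA Ω w f) (interior Ω) := by
  have := mem_closure_iff_comap_neBot.mp f.2
  have hext : ∀ u : holoNearClosure Ω, ∃ G : EuclideanSpace ℂ (Fin m) → ℂ,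
      AnalyticOnNhd ℂ G (interior Ω) ∧ ∀ w : closure Ω, u.1 w = G w := by
    rintro ⟨u, U, G, -, hΩU, hG, huG⟩
    exact ⟨G, hG.mono (interior_subset_closure.trans hΩU), huG⟩
  choose G hG huG using hext
  have hlim : Tendsto (Subtype.val : holoNearClosure Ω → C(closure Ω, ℂ))
    (comap Subtype.val (𝓝 f.1)) (𝓝 f.1) := tendsto_comap
  rw [ContinuousMap.tendsto_iff_tendstoLocallyUniformly] at hlim
  refine analyticOnNhd_of_tendstoLocallyUniformlyOn isOpen_interior (f := G)
    (l := comap Subtype.val (𝓝 f.1)) ?_ hG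
  intro V hV w hw
  obtain ⟨s, hs, hs'⟩ := hlim V hV ⟨w, interior_subset_closure hw⟩
  obtain ⟨t, ht, hts⟩ := (mem_nhds_induced _ _ _).mp hs
  refine ⟨t ∩ interior Ω, inter_mem (mem_nhdsWithin_of_mem_nhds ht) self_mem_nhdsWithin, ?_⟩
  filter_upwards [hs'] with u hu z ⟨hzt, hz⟩
  rw [evalA_of_mem (interior_subset_closure hz), ← huG u ⟨z, interior_subset_closure hz⟩]
  exact hu _ (hts hzt)

/-- A linear functional on the ambient space, as an element of `𝒜(Ω)`: the coordinates of a point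
and of a tangent vector can be read off from these functions. -/
noncomputable def AlgA.ofDual (Ω : Set (EuclideanSpace ℂ (Fin m)))
    (ℓ : StrongDual ℂ (EuclideanSpace ℂ (Fin m))) : AlgA Ω :=
  ⟨⟨fun w => ℓ w, ℓ.continuous.comp continuous_subtype_val⟩,
    subset_closure ⟨univ, ℓ, isOpen_univ, subset_univ _, ℓ.analyticOnNhd _, fun _ => rfl⟩⟩

theorem evalA_ofDual (hw : w ∈ closure Ω) (ℓ : StrongDual ℂ (EuclideanSpace ℂ (Fin m))) :
    evalA Ω w (AlgA.ofDual Ω ℓ) = ℓ w := by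
  rw [evalA_of_mem hw]; rfl

end FunctionAlgebra

namespace QuasiFree

variable {m : ℕ} {Ω : Set (EuclideanSpace ℂ (Fin m))} {w : EuclideanSpace ℂ (Fin m)}
  {H : Type*} [NormedAddCommGroup H] [InnerProductSpace ℂ H] [CompleteSpace H]
  (M : QuasiFree Ω H)

theorem eval_locally_bounded (hw : w ∈ interior Ω) :
    ∃ V ∈ 𝓝 w, ∃ C : ℝ, ∀ z ∈ V, ‖M.eval z‖ ≤ C := by
  obtain ⟨V, hV, C, hC⟩ := M.eval_bounded w (interior_subset hw)
  refine ⟨V ∩ Ω, inter_mem hV (mem_interior_iff_mem_nhds.mp hw), max C 0, fun z hz => ?_⟩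
  refine LinearMap.opNorm_extendOfNorm_le M.emb_dense (le_max_right _ _) fun f => ?_
  exact (hC z hz f).trans (mul_le_mul_of_nonneg_right (le_max_left _ _) (norm_nonneg _))

theorem eval_act (hw : w ∈ Ω) (f : AlgA Ω) (x : H) :
    M.eval w (M.act f x) = evalA Ω w f * M.eval w x := by
  refine M.emb_dense.induction_on x (isClosed_eq (by fun_prop) (by fun_prop)) fun g => ?_
  rw [act_emb, eval_emb M hw, eval_emb M hw, evalA_mul (subset_closure hw)]

theorem analyticOnNhd_eval_apply (x : H) :
    AnalyticOnNhd ℂ (fun w => M.eval w x) (interior Ω) := by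
  obtain ⟨u, hu, hlim⟩ := mem_closure_iff_seq_limit.mp (M.emb_dense x)
  choose f hf using hu
  have hfa : ∀ n, AnalyticOnNhd ℂ (fun w => M.eval w (u n)) (interior Ω) := fun n =>
    (analyticOnNhd_evalA (f n)).congr isOpen_interior fun w hw => by
      simp only [← hf n, eval_emb M (interior_subset hw)]
  refine analyticOnNhd_of_tendstoLocallyUniformlyOn isOpen_interior
    (f := fun n w => M.eval w (u n)) (l := atTop) ?_ hfa
  rw [Metric.tendstoLocallyUniformlyOn_iff]
  intro ε hε w hw
  obtain ⟨V, hV, C, hC⟩ := M.eval_locally_bounded hw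
  refine ⟨V, mem_nhdsWithin_of_mem_nhds hV, ?_⟩
  have hbound : Tendsto (fun n => C * ‖x - u n‖) atTop (𝓝 0) := by
    simpa using ((hlim.const_sub x).norm).const_mul C
  filter_upwards [hbound.eventually_lt_const hε] with n hn z hz
  rw [dist_eq_norm, ← map_sub]
  exact ((M.eval z).le_of_opNorm_le (hC z hz) _).trans_lt hn

theorem analyticOnNhd_eval : AnalyticOnNhd ℂ M.eval (interior Ω) :=
  analyticOnNhd_clm_of_locally_bounded isOpen_interior
    (fun x => (M.analyticOnNhd_eval_apply x).differentiableOn) fun _ hz => M.eval_locally_bounded hz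

end QuasiFree

section Division

open Metric

variable {E : Type*} [NormedAddCommGroup E] [NormedSpace ℂ E]

theorem exists_apply_eq_one {L : StrongDual ℂ E} (hL : L ≠ 0) : ∃ n, L n = 1 := by
  obtain ⟨v, hv⟩ := DFunLike.ne_iff.mp hL
  exact ⟨(L v)⁻¹ • v, by simpa using inv_mul_cancel₀ hv⟩

theorem differentiableAt_comp_line {F : Type*} [NormedAddCommGroup F] [NormedSpace ℂ F]
    {f : E → F} {z v : E} {t : ℂ} (hf : DifferentiableAt ℂ f (z + t • v)) :
    DifferentiableAt ℂ (fun s : ℂ => f (z + s • v)) t :=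
  hf.comp t ((differentiableAt_id.smul_const v).const_add z)

section Linear

variable {F : Type*} [NormedAddCommGroup F] [NormedSpace ℂ F] {f : E → F} {n z : E}
  {L : StrongDual ℂ E}

/-- The quotient of `f` by the linear form `L`. On the hyperplane `L = 0`, where a function `f`
vanishing there is to be divided, its value is the derivative of `f` in the direction `n`. -/
noncomputable def linearQuotient (f : E → F) (L : StrongDual ℂ E) (n y : E) : F :=
  open Classical in if L y = 0 then fderiv ℂ f y n else (L y)⁻¹ • f y

theorem linearQuotient_eventuallyEq (hz : L z ≠ 0) :
    linearQuotient f L n =ᶠ[𝓝 z] fun y => (L y)⁻¹ • f y := by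
  filter_upwards [L.continuous.continuousAt.eventually_ne hz] with y hy using if_neg hy

theorem analyticAt_linearQuotient_of_ne_zero (hf : AnalyticAt ℂ f z) (hz : L z ≠ 0) :
    AnalyticAt ℂ (linearQuotient f L n) z :=
  (((L.analyticAt z).inv hz).smul hf).congr (linearQuotient_eventuallyEq hz).symm

-- Strict differentiability at `z`, applied to `y` and its projection `y - L y • n` to `L = 0`.
theorem tendsto_inv_smul_of_hasStrictFDerivAt {f' : E →L[ℂ] F} (hf : HasStrictFDerivAt f f' z)
    (hn : L n = 1) (hz : L z = 0) (h0 : ∀ᶠ y in 𝓝 z, L y = 0 → f y = 0) :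
    Tendsto (fun y => (L y)⁻¹ • f y) (𝓝[{y | L y ≠ 0}] z) (𝓝 (f' n)) := by
  have hproj : Tendsto (fun y => y - L y • n) (𝓝 z) (𝓝 z) := by
    have : Continuous fun y => y - L y • n := by fun_prop
    simpa [hz] using this.tendsto z
  have hpair : Tendsto (fun y => (y, y - L y • n)) (𝓝[{y | L y ≠ 0}] z) (𝓝 (z, z)) :=
    (tendsto_id.prodMk_nhds hproj).mono_left nhdsWithin_le_nhds
  have hsmall : (fun y => f y - L y • f' n) =o[𝓝[{y | L y ≠ 0}] z] fun y => L y • n := by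
    refine (hf.isLittleO.comp_tendsto hpair).congr' ?_ (Eventually.of_forall fun y => by simp)
    filter_upwards [nhdsWithin_le_nhds (hproj.eventually h0)] with y hy
    simp [hy (by simp [hn])]
  have hquot : (fun y => (L y)⁻¹ • (f y - L y • f' n)) =o[𝓝[{y | L y ≠ 0}] z] fun _ => n := by
    refine ((Asymptotics.isBigO_refl (fun y => (L y)⁻¹) _).smul_isLittleO hsmall).congr' .rfl ?_
    filter_upwards [self_mem_nhdsWithin] with y hy using inv_smul_smul₀ hy n
  have hlim := ((Asymptotics.isLittleO_one_iff ℝ).mp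
    (hquot.trans_isBigO (Asymptotics.isBigO_const_one ℝ n _))).add_const (f' n)
  rw [zero_add] at hlim
  refine hlim.congr' ?_
  filter_upwards [self_mem_nhdsWithin] with y hy
  rw [smul_sub, inv_smul_smul₀ hy, sub_add_cancel]

theorem continuousAt_linearQuotient [CompleteSpace F] (hf : AnalyticAt ℂ f z)
    (hn : L n = 1) (hz : L z = 0)
    (h0 : ∀ᶠ y in 𝓝 z, L y = 0 → f y = 0) : ContinuousAt (linearQuotient f L n) z := by
  have hval : linearQuotient f L n z = fderiv ℂ f z n := if_pos hz
  rw [ContinuousAt, hval, ← nhdsWithin_univ, ← union_compl_self {y | L y = 0}, nhdsWithin_union,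
    tendsto_sup]
  constructor
  · refine Tendsto.congr' ?_ (hf.fderiv.continuousAt.clm_apply
      continuousAt_const).continuousWithinAt
    filter_upwards [self_mem_nhdsWithin] with y hy using (if_pos hy).symm
  · refine (tendsto_inv_smul_of_hasStrictFDerivAt hf.hasStrictFDerivAt hn hz h0).congr' ?_
    filter_upwards [self_mem_nhdsWithin] with y hy using (if_neg hy).symm

-- On a line through `z` that is transverse to `L = 0`, the singularity at `z` is removable.
theorem differentiableAt_linearQuotient_line [CompleteSpace F] (hf : AnalyticAt ℂ f z)
    (hn : L n = 1) (hz : L z = 0) (h0 : ∀ᶠ y in 𝓝 z, L y = 0 → f y = 0) (v : E) :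
    DifferentiableAt ℂ (fun t : ℂ => linearQuotient f L n (z + t • v)) 0 := by
  have hline : Tendsto (fun t : ℂ => z + t • v) (𝓝 0) (𝓝 z) := by
    have : Continuous fun t : ℂ => z + t • v := by fun_prop
    simpa using this.tendsto 0
  by_cases hv : L v = 0
  · have heq : ∀ t : ℂ, linearQuotient f L n (z + t • v) = fderiv ℂ f (z + t • v) n := fun t =>
      if_pos (by simp [hz, hv])
    simp only [heq]
    refine differentiableAt_comp_line (f := fun y => fderiv ℂ f y n) ?_
    simpa using hf.fderiv.differentiableAt.clm_apply (differentiableAt_const n)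
  · refine (Complex.analyticAt_of_differentiable_on_punctured_nhds_of_continuousAt ?_
      ?_).differentiableAt
    · filter_upwards [nhdsWithin_le_nhds (hline.eventually hf.eventually_analyticAt),
        self_mem_nhdsWithin] with t ht ht0
      have hLt : L (z + t • v) ≠ 0 := by simpa [hz] using ⟨ht0, hv⟩
      exact differentiableAt_comp_line
        (analyticAt_linearQuotient_of_ne_zero ht hLt).differentiableAt
    · exact (continuousAt_linearQuotient hf hn hz h0).comp_of_eq (by fun_prop) (by simp)

theorem exists_eq_linear_smul [FiniteDimensional ℂ E] [CompleteSpace F] {p : E}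
    (hf : AnalyticAt ℂ f p) (hL : L ≠ 0) (h0 : ∀ᶠ y in 𝓝 p, L y = 0 → f y = 0) :
    ∃ g : E → F, AnalyticAt ℂ g p ∧ ∀ᶠ y in 𝓝 p, f y = L y • g y := by
  obtain ⟨n, hn⟩ := exists_apply_eq_one hL
  obtain ⟨r, hr, hball⟩ := nhds_basis_ball.eventually_iff.mp (hf.eventually_analyticAt.and h0)
  have h0' : ∀ z ∈ ball p r, ∀ᶠ y in 𝓝 z, L y = 0 → f y = 0 := fun z hz =>
    eventually_of_mem (isOpen_ball.mem_nhds hz) fun y hy => (hball hy).2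
  refine ⟨linearQuotient f L n, ?_, ?_⟩
  · refine analyticOnNhd_of_continuousOn_of_line isOpen_ball (fun z hz => ?_) (fun z hz v => ?_) p
      (mem_ball_self hr)
    · by_cases hLz : L z = 0
      · exact (continuousAt_linearQuotient (hball hz).1 hn hLz (h0' z hz)).continuousWithinAt
      · exact (analyticAt_linearQuotient_of_ne_zero (hball hz).1
          hLz).continuousAt.continuousWithinAt
    · by_cases hLz : L z = 0
      · exact differentiableAt_linearQuotient_line (hball hz).1 hn hLz (h0' z hz) v
      · refine differentiableAt_comp_line ?_
        simpa using (analyticAt_linearQuotient_of_ne_zero (hball hz).1 hLz).differentiableAt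
  · filter_upwards [ball_mem_nhds p hr] with y hy
    by_cases hLy : L y = 0
    · rw [(hball hy).2 hLy, hLy, zero_smul]
    · rw [linearQuotient, if_neg hLy, smul_inv_smul₀ hLy]

end Linear

variable [FiniteDimensional ℂ E] {φ : E → ℂ} {p : E}

theorem exists_analyticAt_inverse {Ψ : E → E} (hΨ : AnalyticAt ℂ Ψ p)
    (hd : fderiv ℂ Ψ p = ContinuousLinearMap.id ℂ E) :
    ∃ G : E → E, AnalyticAt ℂ G (Ψ p) ∧ G (Ψ p) = p ∧ (∀ᶠ z in 𝓝 p, G (Ψ z) = z) ∧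
      (∀ᶠ y in 𝓝 (Ψ p), Ψ (G y) = y) ∧ fderiv ℂ G (Ψ p) = ContinuousLinearMap.id ℂ E := by
  have hs : HasStrictFDerivAt Ψ (ContinuousLinearEquiv.refl ℂ E : E →L[ℂ] E) p := by
    have := hΨ.hasStrictFDerivAt
    rwa [hd] at this
  let R := hs.toOpenPartialHomeomorph Ψ
  have hp : p ∈ R.source := hs.mem_toOpenPartialHomeomorph_source
  have hG : AnalyticAt ℂ R.symm (Ψ p) :=
    R.analyticAt_symm' (i := ContinuousLinearEquiv.refl ℂ E) hp hΨ hd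
  exact ⟨R.symm, hG, R.left_inv hp, R.eventually_left_inverse hp,
    R.eventually_right_inverse (R.map_source hp), hs.to_localInverse.hasFDerivAt.fderiv⟩

theorem exists_straightening (hφ : AnalyticAt ℂ φ p) (h0 : φ p = 0) (hd : fderiv ℂ φ p ≠ 0) :
    ∃ Ψ G : E → E, AnalyticAt ℂ Ψ p ∧ AnalyticAt ℂ G 0 ∧ Ψ p = 0 ∧ G 0 = p ∧
      (∀ᶠ z in 𝓝 p, G (Ψ z) = z) ∧ (∀ᶠ y in 𝓝 0, Ψ (G y) = y) ∧
      (∀ z, fderiv ℂ φ p (Ψ z) = φ z) ∧ fderiv ℂ G 0 = ContinuousLinearMap.id ℂ E := by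
  obtain ⟨n, hn⟩ := exists_apply_eq_one hd
  have hsub : AnalyticAt ℂ (fun z => z - p) p := analyticAt_id.sub analyticAt_const
  let Ψ : E → E := fun z => (z - p) + (φ z - fderiv ℂ φ p (z - p)) • n
  have hΨ : AnalyticAt ℂ Ψ p :=
    hsub.add ((hφ.sub (((fderiv ℂ φ p).analyticAt _).comp hsub)).smul analyticAt_const)
  have hΨp : Ψ p = 0 := by simp [Ψ, h0]
  have hΨd : HasFDerivAt Ψ (ContinuousLinearMap.id ℂ E) p := by
    have hsub' := (hasFDerivAt_id (𝕜 := ℂ) p).sub_const p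
    refine (hsub'.add ((hφ.differentiableAt.hasFDerivAt.sub
      ((fderiv ℂ φ p).hasFDerivAt.comp p hsub')).smul_const n)).congr_fderiv ?_
    simp
  obtain ⟨G, hG, hGp, hGΨ, hΨG, hGd⟩ := exists_analyticAt_inverse hΨ hΨd.fderiv
  rw [hΨp] at hG hGp hΨG hGd
  refine ⟨Ψ, G, hΨ, hG, hΨp, hGp, hGΨ, hΨG, fun z => ?_, hGd⟩
  simp only [Ψ, map_add, map_smul, hn, smul_eq_mul]
  ring

theorem exists_eq_smul_of_eq_zero {F : Type*} [NormedAddCommGroup F] [NormedSpace ℂ F]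
    [CompleteSpace F] {f : E → F} (hφ : AnalyticAt ℂ φ p) (h0 : φ p = 0)
    (hd : fderiv ℂ φ p ≠ 0) (hf : AnalyticAt ℂ f p) (hfφ : ∀ᶠ z in 𝓝 p, φ z = 0 → f z = 0) :
    ∃ g : E → F, AnalyticAt ℂ g p ∧ ∀ᶠ z in 𝓝 p, f z = φ z • g z := by
  obtain ⟨Ψ, G, hΨ, hG, hΨp, hGp, hGΨ, hΨG, hL, -⟩ := exists_straightening hφ h0 hd
  have hGt : Tendsto G (𝓝 0) (𝓝 p) := hGp ▸ hG.continuousAt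
  have hΨt : Tendsto Ψ (𝓝 p) (𝓝 0) := hΨp ▸ hΨ.continuousAt
  obtain ⟨g, hg, hfg⟩ := exists_eq_linear_smul (f := f ∘ G) (hf.comp_of_eq hG hGp) hd (by
    filter_upwards [hGt.eventually hfφ, hΨG] with y hy hyG hLy
    exact hy (by rw [← hL, hyG, hLy]))
  refine ⟨g ∘ Ψ, hg.comp_of_eq hΨ hΨp, ?_⟩
  filter_upwards [hΨt.eventually hfg, hGΨ] with z hz hzG
  simpa only [Function.comp_apply, hzG, hL] using hz

theorem exists_eq_sq_smul_of_eq_zero {F : Type*} [NormedAddCommGroup F] [NormedSpace ℂ F]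
    [CompleteSpace F] {f : E → F} (hφ : AnalyticAt ℂ φ p) (h0 : φ p = 0)
    (hd : fderiv ℂ φ p ≠ 0) (hf : AnalyticAt ℂ f p)
    (hfφ : ∀ᶠ z in 𝓝 p, φ z = 0 → f z = 0 ∧ fderiv ℂ f z = 0) :
    ∃ g : E → F, AnalyticAt ℂ g p ∧ ∀ᶠ z in 𝓝 p, f z = φ z ^ 2 • g z := by
  obtain ⟨g, hg, hfg⟩ := exists_eq_smul_of_eq_zero hφ h0 hd hf (hfφ.mono fun z h hz => (h hz).1)
  have hg0 : ∀ᶠ z in 𝓝 p, φ z = 0 → g z = 0 := by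
    filter_upwards [hfφ, hfg.eventually_nhds, hφ.fderiv.continuousAt.eventually_ne hd,
      hg.eventually_analyticAt, hφ.eventually_analyticAt] with z hfz hfgz hdz hgz hφz hz
    have hleibniz : fderiv ℂ f z = φ z • fderiv ℂ g z + (fderiv ℂ φ z).smulRight (g z) := by
      rw [EventuallyEq.fderiv_eq hfgz]
      exact fderiv_fun_smul hφz.differentiableAt hgz.differentiableAt
    obtain ⟨v, hv⟩ := exists_apply_eq_one hdz
    simpa [(hfz hz).2, hz, hv] using (DFunLike.congr_fun hleibniz v).symm
  obtain ⟨g₂, hg₂, hgg₂⟩ := exists_eq_smul_of_eq_zero hφ h0 hd hg hg0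
  refine ⟨g₂, hg₂, ?_⟩
  filter_upwards [hfg, hgg₂] with z hfz hgz
  rw [hfz, hgz, smul_smul, sq]

end Division

theorem exists_analyticOnNhd_eq_smul {E F : Type*} [NormedAddCommGroup E] [NormedSpace ℂ E]
    [NormedAddCommGroup F] [NormedSpace ℂ F] [CompleteSpace F] {U : Set E} (hU : IsOpen U)
    {ψ : E → ℂ} {f : E → F} (hψ : ∀ q ∈ U, ∃ᶠ z in 𝓝 q, ψ z ≠ 0)
    (hloc : ∀ q ∈ U, ∃ g : E → F, AnalyticAt ℂ g q ∧ ∀ᶠ z in 𝓝 q, f z = ψ z • g z) :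
    ∃ g : E → F, AnalyticOnNhd ℂ g U ∧ ∀ z ∈ U, f z = ψ z • g z := by
  choose! g hg hfg using hloc
  refine ⟨fun z => g z z, fun q hq => ?_, fun z hz => (hfg z hz).self_of_nhds⟩
  refine (hg q hq).congr ?_
  filter_upwards [(hfg q hq).eventually_nhds, (hg q hq).eventually_analyticAt,
    hU.mem_nhds hq] with z hfz hgz hz
  refine tendsto_nhds_unique_of_frequently_eq hgz.continuousAt (hg z hz).continuousAt ?_
  refine ((hψ z hz).and_eventually (hfz.and (hfg z hz))).mono ?_
  rintro y ⟨hy, hqy, hzy⟩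
  exact smul_right_injective F hy (hqy.symm.trans hzy)

section Hypersurface

variable {m : ℕ} {Ω Z U : Set (EuclideanSpace ℂ (Fin m))} {φ : EuclideanSpace ℂ (Fin m) → ℂ}
  {p : EuclideanSpace ℂ (Fin m)}

namespace IsDefiningFunction

theorem subset_interior (h : IsDefiningFunction Ω Z U φ) : U ⊆ interior Ω :=
  h.isOpen.subset_interior_iff.mpr h.subset

theorem exists_parametrization (h : IsDefiningFunction Ω Z U φ) (hpU : p ∈ U) (hpZ : p ∈ Z) :
    ∃ F : (fderiv ℂ φ p).ker → EuclideanSpace ℂ (Fin m), AnalyticAt ℂ F 0 ∧ F 0 = p ∧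
      (∀ᶠ x in 𝓝 0, F x ∈ Z) ∧ fderiv ℂ F 0 = (fderiv ℂ φ p).ker.subtypeL ∧
      ∀ W ∈ 𝓝 (0 : (fderiv ℂ φ p).ker), ∀ᶠ z in 𝓝[Z] p, z ∈ F '' W := by
  obtain ⟨Ψ, G, hΨ, hG, hΨp, hGp, hGΨ, hΨG, hL, hGd⟩ := exists_straightening (h.holo p hpU)
    ((h.zero_iff p hpU).mpr hpZ) (h.fderiv_ne_zero p ⟨hpU, hpZ⟩)
  have hUp : ∀ᶠ z in 𝓝 p, z ∈ U := h.isOpen.mem_nhds hpU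
  set L := fderiv ℂ φ p
  have hι : Tendsto L.ker.subtypeL (𝓝 0) (𝓝 0) := L.ker.subtypeL.continuous.tendsto' 0 0 rfl
  have hGt : Tendsto G (𝓝 0) (𝓝 p) := hGp ▸ hG.continuousAt
  have hΨt : Tendsto Ψ (𝓝 p) (𝓝 0) := hΨp ▸ hΨ.continuousAt
  refine ⟨G ∘ L.ker.subtypeL, hG.comp_of_eq (L.ker.subtypeL.analyticAt 0) rfl, hGp, ?_, ?_, ?_⟩
  · filter_upwards [hι.eventually hΨG, hι.eventually (hGt.eventually hUp)] with x hx hxU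
    rw [Function.comp_apply, ← h.zero_iff _ hxU, ← hL, hx]
    exact x.2
  · have hG' : HasFDerivAt G (ContinuousLinearMap.id ℂ _) (L.ker.subtypeL 0) := by
      rw [← hGd]
      exact hG.differentiableAt.hasFDerivAt
    exact (hG'.comp 0 L.ker.subtypeL.hasFDerivAt).fderiv
  · intro W hW
    obtain ⟨W', hW', hWW'⟩ := (mem_nhds_induced (Subtype.val : L.ker → _) 0 W).mp hW
    rw [eventually_nhdsWithin_iff]
    filter_upwards [hΨt.eventually hW', hGΨ, hUp] with z hzW hz hzU hzZ
    exact ⟨⟨Ψ z, (hL z).trans ((h.zero_iff z hzU).mpr hzZ)⟩, hWW' hzW, hz⟩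

theorem mem_tangentZ_iff (h : IsDefiningFunction Ω Z U φ) (hpU : p ∈ U) (hpZ : p ∈ Z)
    {v : EuclideanSpace ℂ (Fin m)} : v ∈ tangentZ Ω Z p ↔ fderiv ℂ φ p v = 0 := by
  refine ⟨fun hv => hv U φ h hpU, fun hv V ψ hψ hpV => ?_⟩
  obtain ⟨F, hF, hF0, hFZ, hFd, -⟩ := h.exists_parametrization hpU hpZ
  have hFt : Tendsto F (𝓝 0) (𝓝 p) := by simpa only [ContinuousAt, hF0] using hF.continuousAt
  have hψF : ψ ∘ F =ᶠ[𝓝 0] fun _ => 0 := by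
    filter_upwards [hFZ, hFt.eventually (hψ.isOpen.mem_nhds hpV)] with x hxZ hxV
    exact (hψ.zero_iff _ hxV).mpr hxZ
  have hchain : HasFDerivAt (ψ ∘ F) ((fderiv ℂ ψ p).comp (fderiv ℂ F 0)) 0 := by
    refine HasFDerivAt.comp 0 ?_ hF.differentiableAt.hasFDerivAt
    rw [hF0]
    exact (hψ.holo p hpV).differentiableAt.hasFDerivAt
  have hzero := hchain.unique ((hasFDerivAt_const (0 : ℂ) _).congr_of_eventuallyEq hψF)
  rw [hFd] at hzero
  simpa using DFunLike.congr_fun hzero ⟨v, hv⟩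

theorem frequently_ne_zero (h : IsDefiningFunction Ω Z U φ) (hpU : p ∈ U) :
    ∃ᶠ z in 𝓝 p, φ z ≠ 0 := by
  by_cases hp : φ p = 0
  · intro hev
    have hφ : φ =ᶠ[𝓝 p] fun _ => 0 := hev.mono fun z hz => not_not.mp hz
    exact h.fderiv_ne_zero p ⟨hpU, (h.zero_iff p hpU).mp hp⟩ (by simpa using hφ.fderiv_eq)
  · exact ((h.holo p hpU).continuousAt.eventually_ne hp).frequently

theorem exists_eq_sq_smul {F : Type*} [NormedAddCommGroup F] [NormedSpace ℂ F] [CompleteSpace F]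
    (h : IsDefiningFunction Ω Z U φ) {f : EuclideanSpace ℂ (Fin m) → F}
    (hf : AnalyticOnNhd ℂ f U) (hfZ : ∀ z ∈ U ∩ Z, f z = 0 ∧ fderiv ℂ f z = 0) :
    ∃ g : EuclideanSpace ℂ (Fin m) → F, AnalyticOnNhd ℂ g U ∧ ∀ z ∈ U, f z = φ z ^ 2 • g z := by
  refine exists_analyticOnNhd_eq_smul h.isOpen
    (fun q hq => (h.frequently_ne_zero hq).mono fun z hz => pow_ne_zero 2 hz) fun q hq => ?_
  by_cases h0 : φ q = 0
  · refine exists_eq_sq_smul_of_eq_zero (h.holo q hq) h0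
      (h.fderiv_ne_zero q ⟨hq, (h.zero_iff q hq).mp h0⟩) (hf q hq) ?_
    filter_upwards [h.isOpen.mem_nhds hq] with z hz hφz
    exact hfZ z ⟨hz, (h.zero_iff z hz).mp hφz⟩
  · refine ⟨fun z => (φ z ^ 2)⁻¹ • f z,
      (((h.holo q hq).pow 2).inv (pow_ne_zero 2 h0)).smul (hf q hq), ?_⟩
    filter_upwards [(h.holo q hq).continuousAt.eventually_ne h0] with z hz
    rw [smul_inv_smul₀ (pow_ne_zero 2 hz)]

end IsDefiningFunction

namespace IsHypersurface

theorem subset_interior (hZ : IsHypersurface Ω Z) : Z ⊆ interior Ω := fun p hp =>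
  have ⟨_, _, hφ, hpU⟩ := hZ.2 p hp
  hφ.subset_interior hpU

variable {F : Type*} [NormedAddCommGroup F] [NormedSpace ℂ F] {f : EuclideanSpace ℂ (Fin m) → F}

-- The identity theorem in the connected chart given by a local parametrization.
theorem eventually_eventually_eq_zero_iff (hZ : IsHypersurface Ω Z)
    (hf : AnalyticOnNhd ℂ f (interior Ω)) (hp : p ∈ Z) :
    ∀ᶠ q in 𝓝[Z] p, (∀ᶠ z in 𝓝[Z] p, f z = 0) ↔ ∀ᶠ z in 𝓝[Z] q, f z = 0 := by
  obtain ⟨V, φ, hφ, hpV⟩ := hZ.2 p hp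
  obtain ⟨F, hF, hF0, hFZ, -, hFW⟩ := hφ.exists_parametrization hpV hp
  obtain ⟨ε, hε, hball⟩ := Metric.nhds_basis_ball.eventually_iff.mp
    (hF.eventually_analyticAt.and hFZ)
  have hchart := hFW _ (Metric.ball_mem_nhds 0 hε)
  have hfF : AnalyticOnNhd ℂ (f ∘ F) (Metric.ball 0 ε) := fun b hb =>
    (hf (F b) (hZ.subset_interior (hball hb).2)).comp (hball hb).1
  have hidentity : ∀ c ∈ Metric.ball (0 : (fderiv ℂ φ p).ker) ε,
      (∀ᶠ z in 𝓝[Z] (F c), f z = 0) → ∀ z ∈ F '' Metric.ball 0 ε, f z = 0 := by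
    rintro c hc hev _ ⟨d, hd, rfl⟩
    have hFc : Tendsto F (𝓝 c) (𝓝[Z] (F c)) := tendsto_nhdsWithin_iff.mpr
      ⟨(hball hc).1.continuousAt,
        Filter.mem_of_superset (Metric.isOpen_ball.mem_nhds hc) fun z hz => (hball hz).2⟩
    exact hfF.eqOn_zero_of_preconnected_of_eventuallyEq_zero (convex_ball _ _).isPreconnected hc
      (hFc.eventually hev) hd
  filter_upwards [hchart, eventually_eventually_nhdsWithin.mpr hchart] with q hq hqchart
  obtain ⟨b, hb, rfl⟩ := hq
  refine ⟨fun hev => ?_, fun hev => ?_⟩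
  · filter_upwards [hqchart] with z hz
    exact hidentity 0 (Metric.mem_ball_self hε) (hF0.symm ▸ hev) z hz
  · filter_upwards [hchart] with z hz using hidentity b hb hev z hz

theorem eqOn_zero_of_isPreconnected (hZ : IsHypersurface Ω Z) (hZc : IsPreconnected Z)
    (hf : AnalyticOnNhd ℂ f (interior Ω)) (hp : p ∈ Z) (h0 : ∀ᶠ z in 𝓝[Z] p, f z = 0) :
    EqOn f 0 Z := by
  intro z hz
  have hiff := hZc.induction₂
    (fun x y => (∀ᶠ z in 𝓝[Z] x, f z = 0) ↔ ∀ᶠ z in 𝓝[Z] y, f z = 0)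
    (fun x hx => hZ.eventually_eventually_eq_zero_iff hf hx)
    (fun _ _ _ _ _ _ => Iff.trans) (fun _ _ _ _ => Iff.symm) hp hz
  exact (hiff.mp h0).self_of_nhdsWithin hz

end IsHypersurface

end Hypersurface

section OneJet

variable {E G G' : Type*} [NormedAddCommGroup E] [NormedSpace ℂ E] [NormedAddCommGroup G]
  [NormedSpace ℂ G] [NormedAddCommGroup G'] [NormedSpace ℂ G'] {e : E → G} {c : E → ℂ} {z : E}

/-- The first order jet of `e` at `z`, as a map on the differential operators `s + ∂_v` of order at
most one, encoded as pairs `(s, v)`. -/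
noncomputable def oneJet (e : E → G) (z : E) : ℂ × E →ₗ[ℂ] G :=
  (LinearMap.toSpanSingleton ℂ G (e z)).coprod (fderiv ℂ e z)

theorem oneJet_apply (e : E → G) (z : E) (ξ : ℂ × E) :
    oneJet e z ξ = ξ.1 • e z + fderiv ℂ e z ξ.2 := rfl

@[simp] theorem oneJet_one_zero (e : E → G) (z : E) : oneJet e z (1, 0) = e z := by
  rw [oneJet_apply, one_smul, map_zero, add_zero]

@[simp] theorem oneJet_zero_left (e : E → G) (z v : E) : oneJet e z (0, v) = fderiv ℂ e z v := by
  rw [oneJet_apply, zero_smul, zero_add]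

theorem oneJet_eq_zero_iff : oneJet e z = 0 ↔ e z = 0 ∧ fderiv ℂ e z = 0 := by
  refine ⟨fun h => ⟨?_, ?_⟩, fun ⟨h, h'⟩ => ?_⟩
  · rw [← oneJet_one_zero e z, h, LinearMap.zero_apply]
  · ext v
    rw [← oneJet_zero_left, h, LinearMap.zero_apply, zero_apply]
  · ext <;> simp [h, h']

theorem oneJet_congr {e' : E → G} (h : e =ᶠ[𝓝 z] e') : oneJet e z = oneJet e' z := by
  rw [oneJet, oneJet, h.eq_of_nhds, h.fderiv_eq]

theorem oneJet_clm_comp (L : G →L[ℂ] G') (he : DifferentiableAt ℂ e z) (ξ : ℂ × E) :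
    oneJet (fun w => L (e w)) z ξ = L (oneJet e z ξ) := by
  have hLe : HasFDerivAt (fun w => L (e w)) (L.comp (fderiv ℂ e z)) z :=
    L.hasFDerivAt.comp z he.hasFDerivAt
  rw [oneJet_apply, oneJet_apply, map_add, map_smul, hLe.fderiv]
  rfl

/-- The composition of a differential operator `ξ = (s, v)` of order at most one with the
multiplication by a function whose first order jet is `ℓ`. -/
def jetMul (ℓ : ℂ × E →ₗ[ℂ] ℂ) (ξ : ℂ × E) : ℂ × E := (ℓ ξ, ℓ (1, 0) • ξ.2)

theorem jetMul_apply_swap (ℓ k : ℂ × E →ₗ[ℂ] ℂ) (ξ : ℂ × E) : ℓ (jetMul k ξ) = k (jetMul ℓ ξ) := by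
  have hsplit : ∀ (j : ℂ × E →ₗ[ℂ] ℂ) (s : ℂ) (v : E), j (s, v) = s * j (1, 0) + j (0, v) := by
    intro j s v
    rw [← smul_eq_mul, ← map_smul, ← map_add]
    simp
  have hvec : ∀ (j : ℂ × E →ₗ[ℂ] ℂ) (s : ℂ) (v : E), j (0, s • v) = s * j (0, v) := by
    intro j s v
    rw [← smul_eq_mul, ← map_smul, Prod.smul_mk, smul_zero]
  obtain ⟨s, v⟩ := ξ
  simp only [jetMul]
  rw [hsplit ℓ, hsplit k (ℓ (s, v)), hvec, hvec, hsplit k s, hsplit ℓ s]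
  ring

theorem jetMul_comm (ℓ k : ℂ × E →ₗ[ℂ] ℂ) (ξ : ℂ × E) :
    jetMul ℓ (jetMul k ξ) = jetMul k (jetMul ℓ ξ) :=
  Prod.ext (jetMul_apply_swap ℓ k ξ) (smul_comm (ℓ (1, 0)) (k (1, 0)) ξ.2)

theorem jetMul_surjective {ℓ : ℂ × E →ₗ[ℂ] ℂ} (h : ℓ (1, 0) ≠ 0) :
    Function.Surjective (jetMul ℓ) := by
  rintro ⟨s, v⟩
  set w := (ℓ (1, 0))⁻¹ • v
  refine ⟨((s - ℓ (0, w)) / ℓ (1, 0), w), Prod.ext ?_ (smul_inv_smul₀ h v)⟩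
  have hsplit : ((s - ℓ (0, w)) / ℓ (1, 0), w) =
      ((s - ℓ (0, w)) / ℓ (1, 0)) • ((1, 0) : ℂ × E) + (0, w) := by simp
  rw [jetMul, hsplit, map_add, map_smul, smul_eq_mul, div_mul_cancel₀ _ h, sub_add_cancel]

theorem oneJet_smul (hc : DifferentiableAt ℂ c z) (he : DifferentiableAt ℂ e z) (ξ : ℂ × E) :
    oneJet (fun w => c w • e w) z ξ = oneJet e z (jetMul (oneJet c z) ξ) := by
  simp only [oneJet_apply, jetMul, fderiv_fun_smul hc he, map_smul, map_zero, smul_eq_mul,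
    add_apply, smul_apply, ContinuousLinearMap.smulRight_apply]
  module

end OneJet

section DualInner

variable {X : Type*} [NormedAddCommGroup X] [InnerProductSpace ℂ X] [CompleteSpace X]

/-- The inner product of two functionals, linear in the first variable. For the evaluation
functionals `e` of a Hilbert space of functions it is the reproducing kernel:
`K (z, w) = dualInner (e z) (e w)`. -/
noncomputable def dualInner (a b : StrongDual ℂ X) : ℂ := a ((InnerProductSpace.toDual ℂ X).symm b)

theorem dualInner_eq_inner (a b : StrongDual ℂ X) : dualInner a b =
    inner ℂ ((InnerProductSpace.toDual ℂ X).symm a) ((InnerProductSpace.toDual ℂ X).symm b) := by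
  rw [InnerProductSpace.toDual_symm_apply, dualInner]

theorem dualInner_conj (a b : StrongDual ℂ X) :
    (starRingEnd ℂ) (dualInner a b) = dualInner b a := by
  rw [dualInner_eq_inner, dualInner_eq_inner, inner_conj_symm]

@[simp] theorem dualInner_smul_left (r : ℂ) (a c : StrongDual ℂ X) :
    dualInner (r • a) c = r * dualInner a c := rfl

@[simp] theorem dualInner_add_left (a b c : StrongDual ℂ X) :
    dualInner (a + b) c = dualInner a c + dualInner b c := rfl

@[simp] theorem dualInner_add_right (a b c : StrongDual ℂ X) :
    dualInner a (b + c) = dualInner a b + dualInner a c := by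
  simp [dualInner]

@[simp] theorem dualInner_sub_left (a b c : StrongDual ℂ X) :
    dualInner (a - b) c = dualInner a c - dualInner b c := rfl

@[simp] theorem dualInner_sub_right (a b c : StrongDual ℂ X) :
    dualInner a (b - c) = dualInner a b - dualInner a c := by
  simp [dualInner]

@[simp] theorem dualInner_smul_right (r : ℂ) (a c : StrongDual ℂ X) :
    dualInner a (r • c) = (starRingEnd ℂ) r * dualInner a c := by
  rw [dualInner, LinearIsometryEquiv.map_smulₛₗ, map_smul]
  rfl

theorem dualInner_self (a : StrongDual ℂ X) : dualInner a a = ((‖a‖ ^ 2 : ℝ) : ℂ) := by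
  rw [dualInner_eq_inner, inner_self_eq_norm_sq_to_K, LinearIsometryEquiv.norm_map]
  norm_cast

theorem dualInner_self_ne_zero {a : StrongDual ℂ X} (ha : a ≠ 0) : dualInner a a ≠ 0 := by
  rw [dualInner_self]
  exact_mod_cast (pow_ne_zero 2 (norm_ne_zero_iff.mpr ha))

/-- The Riesz isomorphism, which is only conjugate linear, as a real linear map: this makes it
available to real differentiation. -/
noncomputable def rieszReal (X : Type*) [NormedAddCommGroup X] [InnerProductSpace ℂ X]
    [CompleteSpace X] :
    StrongDual ℂ X →L[ℝ] X where
  toFun := (InnerProductSpace.toDual ℂ X).symm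
  map_add' := map_add _
  map_smul' r x := by
    rw [← Complex.coe_smul, LinearIsometryEquiv.map_smulₛₗ]
    simp only [Complex.conj_ofReal, Complex.coe_smul, Real.ringHom_apply]
  cont := (InnerProductSpace.toDual ℂ X).symm.continuous

variable {E : Type*} [NormedAddCommGroup E] [NormedSpace ℂ E]
  {a b : E → StrongDual ℂ X} {z : E}

theorem exists_hasFDerivAt_dualInner (ha : DifferentiableAt ℂ a z) (hb : DifferentiableAt ℂ b z) :
    ∃ f' : E →L[ℝ] ℂ, HasFDerivAt (fun w => dualInner (a w) (b w)) f' z ∧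
      ∀ v, f' v = dualInner (fderiv ℂ a z v) (b z) + dualInner (a z) (fderiv ℂ b z v) := by
  have hRiesz : ∀ {c : E → StrongDual ℂ X}, DifferentiableAt ℂ c z → HasFDerivAt
      (fun w => rieszReal X (c w)) ((rieszReal X).comp ((fderiv ℂ c z).restrictScalars ℝ)) z :=
    fun hc => (rieszReal X).hasFDerivAt.comp z (hc.hasFDerivAt.restrictScalars ℝ)
  simp only [dualInner_eq_inner]
  refine ⟨_, (hRiesz ha).inner ℂ (hRiesz hb), fun v => ?_⟩
  rw [ContinuousLinearMap.comp_apply, fderivInnerCLM_apply, add_comm]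
  rfl

theorem differentiableAt_real_dualInner (ha : DifferentiableAt ℂ a z)
    (hb : DifferentiableAt ℂ b z) :
    DifferentiableAt ℝ (fun w => dualInner (a w) (b w)) z := by
  obtain ⟨f', hf', -⟩ := exists_hasFDerivAt_dualInner ha hb
  exact hf'.differentiableAt

theorem dHol_dualInner (ha : DifferentiableAt ℂ a z) (hb : DifferentiableAt ℂ b z) (v : E) :
    dHol (fun w => dualInner (a w) (b w)) z v = dualInner (fderiv ℂ a z v) (b z) := by
  obtain ⟨f', hf', h⟩ := exists_hasFDerivAt_dualInner ha hb
  rw [dHol, hf'.fderiv, h, h, map_smul, map_smul, dualInner_smul_left, dualInner_smul_right]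
  simp only [smul_eq_mul, Complex.conj_I]
  linear_combination (-2⁻¹ * dualInner (fderiv ℂ a z v) (b z) +
    2⁻¹ * dualInner (a z) (fderiv ℂ b z v)) * Complex.I_sq

theorem dBar_dualInner (ha : DifferentiableAt ℂ a z) (hb : DifferentiableAt ℂ b z) (v : E) :
    dBar (fun w => dualInner (a w) (b w)) z v = dualInner (a z) (fderiv ℂ b z v) := by
  obtain ⟨f', hf', h⟩ := exists_hasFDerivAt_dualInner ha hb
  rw [dBar, hf'.fderiv, h, h, map_smul, map_smul, dualInner_smul_left, dualInner_smul_right]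
  simp only [smul_eq_mul, Complex.conj_I]
  linear_combination (2⁻¹ * dualInner (fderiv ℂ a z v) (b z) -
    2⁻¹ * dualInner (a z) (fderiv ℂ b z v)) * Complex.I_sq

end DualInner

section Wirtinger

variable {E : Type*} [NormedAddCommGroup E] [NormedSpace ℂ E] {f g : E → ℂ} {z : E}

theorem dBar_congr {F : Type*} [NormedAddCommGroup F] [NormedSpace ℂ F]
    {f g : E → F} (h : f =ᶠ[𝓝 z] g) (v : E) : dBar f z v = dBar g z v := by
  rw [dBar, dBar, h.fderiv_eq]

theorem dHol_congr {F : Type*} [NormedAddCommGroup F] [NormedSpace ℂ F]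
    {f g : E → F} (h : f =ᶠ[𝓝 z] g) (v : E) : dHol f z v = dHol g z v := by
  rw [dHol, dHol, h.fderiv_eq]

theorem dBar_apply {ι : Type*} [Fintype ι] {σ : E → ι → ℂ} (hσ : DifferentiableAt ℝ σ z) (v : E)
    (i : ι) : dBar σ z v i = dBar (fun w => σ w i) z v := by
  simp [dBar, fderiv_apply hσ]

theorem dBar_neg (f : E → ℂ) (z v : E) : dBar (fun w => -f w) z v = -dBar f z v := by
  simp only [dBar, fderiv_fun_neg, neg_apply, smul_neg, ← neg_add]

theorem dBar_mul (hf : DifferentiableAt ℝ f z) (hg : DifferentiableAt ℝ g z) (v : E) :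
    dBar (fun w => f w * g w) z v = f z * dBar g z v + g z * dBar f z v := by
  simp only [dBar, fderiv_fun_mul hf hg]
  simp only [add_apply, smul_apply, smul_eq_mul]
  ring

theorem hasFDerivAt_inv_of_ne_zero {𝕜 : Type*} [NontriviallyNormedField 𝕜] [NormedAlgebra 𝕜 ℂ]
    {E : Type*} [NormedAddCommGroup E] [NormedSpace 𝕜 E] {f : E → ℂ} {z : E} {f' : E →L[𝕜] ℂ}
    (hf : HasFDerivAt f f' z) (h0 : f z ≠ 0) :
    HasFDerivAt (fun w => (f w)⁻¹) (-((f z) ^ 2)⁻¹ • f') z :=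
  (hasDerivAt_inv h0).comp_hasFDerivAt z hf

theorem dBar_inv (hf : DifferentiableAt ℝ f z) (h0 : f z ≠ 0) (v : E) :
    dBar (fun w => (f w)⁻¹) z v = -((f z) ^ 2)⁻¹ * dBar f z v := by
  simp only [dBar, (hasFDerivAt_inv_of_ne_zero hf.hasFDerivAt h0).fderiv]
  simp only [smul_apply, smul_eq_mul]
  ring

theorem hasFDerivAt_div_of_ne_zero {f g : E → ℂ} {f' g' : E →L[ℂ] ℂ}
    (hf : HasFDerivAt f f' z) (hg : HasFDerivAt g g' z) (h0 : g z ≠ 0) :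
    HasFDerivAt (fun w => f w / g w) ((g z)⁻¹ • f' - (f z / g z ^ 2) • g') z := by
  have h := hf.mul (hasFDerivAt_inv_of_ne_zero hg h0)
  simp only [div_eq_mul_inv]
  refine h.congr_fderiv ?_
  ext v
  simp only [add_apply, smul_apply, sub_apply, smul_eq_mul]
  ring

end Wirtinger

section Curvature

variable {X : Type*} [NormedAddCommGroup X] [InnerProductSpace ℂ X] [CompleteSpace X]
  {E : Type*} [NormedAddCommGroup E] [NormedSpace ℂ E]

/-- The polarized curvature: on the diagonal `w = z` it is the curvature `∂̄_u (h⁻¹ ∂_v h)` of the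
metric `h z = k (z, z)`, where `k (z, w) = dualInner (e z) (e w)`. -/
noncomputable def polarCurvature (e : E → StrongDual ℂ X) (z w v u : E) : ℂ :=
  dualInner (fderiv ℂ e z v) (fderiv ℂ e w u) / dualInner (e z) (e w) -
    dualInner (fderiv ℂ e z v) (e w) * dualInner (e z) (fderiv ℂ e w u) /
      dualInner (e z) (e w) ^ 2

theorem polarCurvature_conj (e : E → StrongDual ℂ X) (z w v u : E) :
    (starRingEnd ℂ) (polarCurvature e z w v u) = polarCurvature e w z u v := by
  simp only [polarCurvature, map_sub, map_div₀, map_mul, map_pow, dualInner_conj]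
  ring

theorem polarCurvature_add_left (e : E → StrongDual ℂ X) (z w v v' u : E) :
    polarCurvature e z w (v + v') u = polarCurvature e z w v u + polarCurvature e z w v' u := by
  simp only [polarCurvature, map_add, dualInner_add_left]
  ring

theorem polarCurvature_smul_left (e : E → StrongDual ℂ X) (z w v u : E) (c : ℂ) :
    polarCurvature e z w (c • v) u = c * polarCurvature e z w v u := by
  simp only [polarCurvature, map_smul, dualInner_smul_left]
  ring

theorem polarCurvature_add_right (e : E → StrongDual ℂ X) (z w v u u' : E) :
    polarCurvature e z w v (u + u') = polarCurvature e z w v u + polarCurvature e z w v u' := by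
  simp only [polarCurvature, map_add, dualInner_add_right]
  ring

theorem polarCurvature_smul_right (e : E → StrongDual ℂ X) (z w v u : E) (c : ℂ) :
    polarCurvature e z w v (c • u) = (starRingEnd ℂ) c * polarCurvature e z w v u := by
  simp only [polarCurvature, map_smul, dualInner_smul_right]
  ring

theorem dBar_inv_mul_dualInner {e a : E → StrongDual ℂ X} {z : E} (he : DifferentiableAt ℂ e z)
    (ha : DifferentiableAt ℂ a z) (h0 : e z ≠ 0) (u : E) :
    dBar (fun w => (dualInner (e w) (e w))⁻¹ * dualInner (a w) (e w)) z u =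
      dualInner (a z) (fderiv ℂ e z u) / dualInner (e z) (e z) -
        dualInner (a z) (e z) * dualInner (e z) (fderiv ℂ e z u) / dualInner (e z) (e z) ^ 2 := by
  have hmetric := differentiableAt_real_dualInner he he
  have hmetric_ne := dualInner_self_ne_zero h0
  have hinv : DifferentiableAt ℝ (fun w => (dualInner (e w) (e w))⁻¹) z :=
    (hasFDerivAt_inv_of_ne_zero hmetric.hasFDerivAt hmetric_ne).differentiableAt
  rw [dBar_mul hinv (differentiableAt_real_dualInner ha he), dBar_inv hmetric hmetric_ne,
    dBar_dualInner he he, dBar_dualInner ha he]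
  ring

theorem eventuallyEq_dHol_dualInner_self {e : E → StrongDual ℂ X} {z : E} (he : AnalyticAt ℂ e z)
    (ν : E → E) : (fun w => dHol (fun w => dualInner (e w) (e w)) w (ν w)) =ᶠ[𝓝 z]
      fun w => dualInner (fderiv ℂ e w (ν w)) (e w) :=
  he.eventually_analyticAt.mono fun _ hw => dHol_dualInner hw.differentiableAt hw.differentiableAt _

theorem curvature_dualInner {m : ℕ} {e : EuclideanSpace ℂ (Fin m) → StrongDual ℂ X}
    {z : EuclideanSpace ℂ (Fin m)} (he : AnalyticAt ℂ e z) (h0 : e z ≠ 0)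
    (u v : EuclideanSpace ℂ (Fin m)) :
    curvature (fun w => dualInner (e w) (e w)) z u v = polarCurvature e z z v u := by
  rw [curvature]
  have hconn : (fun w => (dualInner (e w) (e w))⁻¹ * dHol (fun w => dualInner (e w) (e w)) w v)
      =ᶠ[𝓝 z] fun w => (dualInner (e w) (e w))⁻¹ * dualInner (fderiv ℂ e w v) (e w) :=
    EventuallyEq.rfl.mul (eventuallyEq_dHol_dualInner_self he fun _ => v)
  rw [dBar_congr hconn, dBar_inv_mul_dualInner (a := fun w => fderiv ℂ e w v) he.differentiableAt
    (he.fderiv.differentiableAt.clm_apply (differentiableAt_const v)) h0]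
  rfl

end Curvature

section Polarization

variable {B : Type*} [NormedAddCommGroup B] [NormedSpace ℂ B]

theorem eqOn_zero_of_eq_zero_ofReal {W : Set ℂ} (hW : IsOpen W) (hWc : IsPreconnected W)
    (h0 : (0 : ℂ) ∈ W) {f : ℂ → ℂ} (hf : DifferentiableOn ℂ f W)
    (hreal : ∀ r : ℝ, (r : ℂ) ∈ W → f r = 0) : EqOn f 0 W := by
  have hofReal : Tendsto (fun r : ℝ => (r : ℂ)) (𝓝[≠] 0) (𝓝[≠] 0) :=
    tendsto_nhdsWithin_iff.mpr
      ⟨(Complex.continuous_ofReal.tendsto' 0 0 Complex.ofReal_zero).mono_left nhdsWithin_le_nhds,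
        eventually_mem_nhdsWithin.mono fun r hr => Complex.ofReal_ne_zero.mpr hr⟩
  have hmem : ∀ᶠ r : ℝ in 𝓝[≠] 0, (r : ℂ) ∈ W :=
    (hofReal.mono_right nhdsWithin_le_nhds).eventually (hW.mem_nhds h0)
  exact (hf.analyticOnNhd hW).eqOn_zero_of_preconnected_of_frequently_eq_zero hWc h0
    (hofReal.frequently (hmem.mono hreal).frequently)

-- The points `x` and `y` are the values at `τ = ±i` of a complex affine line `ℓ`, and
-- `S (ℓ τ) (ℓ τ̄)` is holomorphic in `τ` and vanishes for real `τ`.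
theorem eq_zero_of_eq_zero_on_diagonal {D : Set B} (hD : IsOpen D) (hDc : Convex ℝ D)
    {S : B → B → ℂ}
    (hS : ∀ α β, ∀ τ : ℂ, α + τ • β ∈ D → α + (starRingEnd ℂ) τ • β ∈ D →
      DifferentiableAt ℂ (fun τ : ℂ => S (α + τ • β) (α + (starRingEnd ℂ) τ • β)) τ)
    (h0 : ∀ x ∈ D, S x x = 0) {x y : B} (hx : x ∈ D) (hy : y ∈ D) : S x y = 0 := by
  set α : B := midpoint ℝ x y with hα
  set β : B := -(Complex.I / 2) • (x - y) with hβ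
  have hα' : α = (2⁻¹ : ℂ) • (x + y) := by
    rw [hα, midpoint_eq_smul_add, invOf_eq_inv, ← Complex.coe_smul, Complex.ofReal_inv,
      Complex.ofReal_ofNat]
  have hIβ : Complex.I • β = (2⁻¹ : ℂ) • (x - y) := by
    rw [hβ, smul_smul]
    congr 1
    linear_combination (-2⁻¹ : ℂ) * Complex.I_sq
  have hline : Convex ℝ ((fun τ : ℂ => α + τ • β) ⁻¹' D) :=
    (hDc.translate_preimage_right α).linear_preimage
      ((LinearMap.toSpanSingleton ℂ B β).restrictScalars ℝ)
  have hlineo : IsOpen ((fun τ : ℂ => α + τ • β) ⁻¹' D) := hD.preimage (by fun_prop)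
  set W : Set ℂ := (fun τ => α + τ • β) ⁻¹' D ∩ (fun τ => α + (starRingEnd ℂ) τ • β) ⁻¹' D
  have hWo : IsOpen W := hlineo.inter (hlineo.preimage Complex.continuous_conj)
  have hWc : Convex ℝ W := hline.inter (hline.linear_preimage Complex.conjAe.toLinearMap)
  have hαD : α ∈ D := hDc.midpoint_mem hx hy
  have hx' : α + Complex.I • β = x := by
    rw [hα', hIβ]
    module
  have hy' : α + (starRingEnd ℂ) Complex.I • β = y := by
    rw [hα', Complex.conj_I, neg_smul, hIβ]
    module
  have hzero := eqOn_zero_of_eq_zero_ofReal hWo hWc.isPreconnected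
    (f := fun τ => S (α + τ • β) (α + (starRingEnd ℂ) τ • β)) (by simpa [W] using hαD)
    (fun τ hτ => (hS α β τ hτ.1 hτ.2).differentiableWithinAt)
    (fun r hr => by simpa only [Complex.conj_ofReal] using h0 _ hr.1)
    (show Complex.I ∈ W from ⟨by rwa [mem_preimage, hx'], by rwa [mem_preimage, hy']⟩)
  simpa only [hx', hy', Pi.zero_apply] using hzero

variable {X : Type*} [NormedAddCommGroup X] [InnerProductSpace ℂ X] [CompleteSpace X]
  {E : Type*} [NormedAddCommGroup E] [NormedSpace ℂ E]

theorem differentiableAt_dualInner_conj {a b : ℂ → StrongDual ℂ X} {τ : ℂ}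
    (ha : DifferentiableAt ℂ a τ) (hb : DifferentiableAt ℂ b ((starRingEnd ℂ) τ)) :
    DifferentiableAt ℂ (fun t => dualInner (a t) (b ((starRingEnd ℂ) t))) τ :=
  ha.clm_apply (DifferentiableAt.comp_semilinear₂
    ((InnerProductSpace.toDual ℂ X).symm.toContinuousLinearEquiv : StrongDual ℂ X →L⋆[ℂ] X)
    ((starL ℂ : ℂ ≃L⋆[ℂ] ℂ) : ℂ →L⋆[ℂ] ℂ) hb)

theorem differentiableAt_polarCurvature_conj {e : E → StrongDual ℂ X} {a b : ℂ → E} {τ : ℂ}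
    (hea : AnalyticAt ℂ e (a τ)) (heb : AnalyticAt ℂ e (b ((starRingEnd ℂ) τ)))
    (ha : DifferentiableAt ℂ a τ) (hb : DifferentiableAt ℂ b ((starRingEnd ℂ) τ))
    (h0 : dualInner (e (a τ)) (e (b ((starRingEnd ℂ) τ))) ≠ 0) (v u : E) :
    DifferentiableAt ℂ (fun t => polarCurvature e (a t) (b ((starRingEnd ℂ) t)) v u) τ := by
  have ha₀ : DifferentiableAt ℂ (fun t => e (a t)) τ := hea.differentiableAt.comp τ ha
  have hb₀ : DifferentiableAt ℂ (fun t => e (b t)) ((starRingEnd ℂ) τ) :=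
    heb.differentiableAt.comp _ hb
  have ha₁ : DifferentiableAt ℂ (fun t => fderiv ℂ e (a t) v) τ :=
    (hea.fderiv.differentiableAt.comp τ ha).clm_apply (differentiableAt_const v)
  have hb₁ : DifferentiableAt ℂ (fun t => fderiv ℂ e (b t) u) ((starRingEnd ℂ) τ) :=
    (heb.fderiv.differentiableAt.comp _ hb).clm_apply (differentiableAt_const u)
  have hab := differentiableAt_dualInner_conj ha₀ hb₀
  exact ((differentiableAt_dualInner_conj ha₁ hb₁).div hab h0).sub
    (((differentiableAt_dualInner_conj ha₁ hb₀).mul (differentiableAt_dualInner_conj ha₀ hb₁)).div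
      (hab.pow 2) (pow_ne_zero 2 h0))

end Polarization

section LogarithmicDerivative

variable {X : Type*} [NormedAddCommGroup X] [InnerProductSpace ℂ X] [CompleteSpace X]
  {E : Type*} [NormedAddCommGroup E] [NormedSpace ℂ E] {e : E → StrongDual ℂ X} {z w : E}

theorem eqOn_of_smul_fderiv_eq {D : Set E} (hD : IsOpen D) (hDc : IsPreconnected D) {f g : E → ℂ}
    (hf : DifferentiableOn ℂ f D) (hg : DifferentiableOn ℂ g D) (hg0 : ∀ x ∈ D, g x ≠ 0)
    (h : ∀ x ∈ D, g x • fderiv ℂ f x = f x • fderiv ℂ g x) {o : E} (ho : o ∈ D)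
    (hfg : f o = g o) : EqOn f g D := by
  have hdiv : ∀ x ∈ D, HasFDerivAt (fun x => f x / g x) (0 : E →L[ℂ] ℂ) x := by
    intro x hx
    refine (hasFDerivAt_div_of_ne_zero (hf.hasFDerivAt (hD.mem_nhds hx))
      (hg.hasFDerivAt (hD.mem_nhds hx)) (hg0 x hx)).congr_fderiv ?_
    rw [sub_eq_zero, div_eq_mul_inv, mul_comm, mul_smul, ← h x hx, smul_smul]
    congr 1
    field_simp [hg0 x hx]
  intro x hx
  rw [← div_eq_one_iff_eq (hg0 x hx)]
  exact hD.eqOn_of_fderiv_eq hDc (f := fun x => f x / g x) (g := fun _ => 1)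
    (fun x hx => (hdiv x hx).differentiableAt.differentiableWithinAt) (differentiableOn_const 1)
    (fun x hx => by rw [(hdiv x hx).fderiv, fderiv_const_apply]) ho
    (by rw [hfg, div_self (hg0 o ho)]) hx

/-- The polarized connection form `k⁻¹ ∂_v k` of the kernel `k (z, w) = dualInner (e z) (e w)`. -/
noncomputable def polarConnection (e : E → StrongDual ℂ X) (z w v : E) : ℂ :=
  dualInner (fderiv ℂ e z v) (e w) / dualInner (e z) (e w)

theorem polarConnection_conj (e : E → StrongDual ℂ X) (z w u : E) :
    (starRingEnd ℂ) (polarConnection e w z u) =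
      dualInner (e z) (fderiv ℂ e w u) / dualInner (e z) (e w) := by
  rw [polarConnection, map_div₀, dualInner_conj, dualInner_conj]

theorem hasFDerivAt_dualInner_left (he : DifferentiableAt ℂ e z) (b : StrongDual ℂ X) :
    HasFDerivAt (fun z => dualInner (e z) b)
      ((fderiv ℂ e z).flip ((InnerProductSpace.toDual ℂ X).symm b)) z :=
  ((ContinuousLinearMap.apply ℂ ℂ ((InnerProductSpace.toDual ℂ X).symm b)).hasFDerivAt.comp z
    he.hasFDerivAt)

theorem differentiableAt_polarConnection_conj (he : DifferentiableAt ℂ e z)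
    (h0 : dualInner (e z) (e w) ≠ 0) (u : E) :
    DifferentiableAt ℂ (fun z => (starRingEnd ℂ) (polarConnection e w z u)) z := by
  simp only [polarConnection_conj]
  exact (hasFDerivAt_div_of_ne_zero (hasFDerivAt_dualInner_left he _)
    (hasFDerivAt_dualInner_left he _) h0).differentiableAt

theorem fderiv_polarConnection_conj (he : DifferentiableAt ℂ e z)
    (h0 : dualInner (e z) (e w) ≠ 0) (u v : E) :
    fderiv ℂ (fun z => (starRingEnd ℂ) (polarConnection e w z u)) z v =
      polarCurvature e z w v u := by
  simp only [polarConnection_conj]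
  rw [(hasFDerivAt_div_of_ne_zero (hasFDerivAt_dualInner_left he _)
    (hasFDerivAt_dualInner_left he _) h0).fderiv]
  simp only [sub_apply, smul_apply, ContinuousLinearMap.flip_apply, smul_eq_mul, polarCurvature,
    dualInner]
  ring

end LogarithmicDerivative

section Rigidity

variable {X X' : Type*} [NormedAddCommGroup X] [InnerProductSpace ℂ X] [CompleteSpace X]
  [NormedAddCommGroup X'] [InnerProductSpace ℂ X'] [CompleteSpace X']
  {E B : Type*} [NormedAddCommGroup E] [NormedSpace ℂ E] [NormedAddCommGroup B] [NormedSpace ℂ B]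
  {e : E → StrongDual ℂ X} {e' : E → StrongDual ℂ X'} {V : Set E} {D : Set B} {F : B → E} {o : B}

theorem polarCurvature_eq_of_diagonal (he : AnalyticOnNhd ℂ e V) (he' : AnalyticOnNhd ℂ e' V)
    (hD : IsOpen D) (hDc : Convex ℝ D) (hF : DifferentiableOn ℂ F D) (hFV : MapsTo F D V)
    (h0 : ∀ z ∈ V, ∀ w ∈ V, dualInner (e z) (e w) ≠ 0)
    (h0' : ∀ z ∈ V, ∀ w ∈ V, dualInner (e' z) (e' w) ≠ 0)
    (hcurv : ∀ x ∈ D, ∀ v u, polarCurvature e (F x) (F x) v u = polarCurvature e' (F x) (F x) v u)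
    {x y : B} (hx : x ∈ D) (hy : y ∈ D) (v u : E) :
    polarCurvature e (F x) (F y) v u = polarCurvature e' (F x) (F y) v u := by
  rw [← sub_eq_zero]
  refine eq_zero_of_eq_zero_on_diagonal
    (S := fun x y => polarCurvature e (F x) (F y) v u - polarCurvature e' (F x) (F y) v u)
    hD hDc ?_ (fun x hx => sub_eq_zero.mpr (hcurv x hx v u)) hx hy
  intro α β τ hτ hτ'
  have hFline : ∀ t : ℂ, α + t • β ∈ D → DifferentiableAt ℂ (fun t : ℂ => F (α + t • β)) t :=
    fun t ht => (hF.differentiableAt (hD.mem_nhds ht)).comp t (f := fun t : ℂ => α + t • β)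
      (by fun_prop)
  exact (differentiableAt_polarCurvature_conj (he _ (hFV hτ)) (he _ (hFV hτ')) (hFline τ hτ)
    (hFline _ hτ') (h0 _ (hFV hτ) _ (hFV hτ')) v u).sub
    (differentiableAt_polarCurvature_conj (he' _ (hFV hτ)) (he' _ (hFV hτ')) (hFline τ hτ)
      (hFline _ hτ') (h0' _ (hFV hτ) _ (hFV hτ')) v u)

theorem polarConnection_eq_of_polarCurvature_eq (he : AnalyticOnNhd ℂ e V)
    (he' : AnalyticOnNhd ℂ e' V) (hD : IsOpen D) (hDc : IsPreconnected D)
    (hF : DifferentiableOn ℂ F D) (hFV : MapsTo F D V)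
    (h0 : ∀ z ∈ V, ∀ w ∈ V, dualInner (e z) (e w) ≠ 0)
    (h0' : ∀ z ∈ V, ∀ w ∈ V, dualInner (e' z) (e' w) ≠ 0) {z u : E} (hz : z ∈ V)
    (hcurv : ∀ y ∈ D, ∀ v, polarCurvature e (F y) z v u = polarCurvature e' (F y) z v u)
    (ho : o ∈ D) (hbase : polarConnection e z (F o) u = polarConnection e' z (F o) u)
    {y : B} (hy : y ∈ D) : polarConnection e z (F y) u = polarConnection e' z (F y) u := by
  have hFd : ∀ y ∈ D, HasFDerivAt F (fderiv ℂ F y) y :=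
    fun y hy => hF.hasFDerivAt (hD.mem_nhds hy)
  have hd : ∀ y ∈ D, HasFDerivAt (fun y => (starRingEnd ℂ) (polarConnection e z (F y) u)) _ y :=
    fun y hy => (differentiableAt_polarConnection_conj (he _ (hFV hy)).differentiableAt
      (h0 _ (hFV hy) z hz) u).hasFDerivAt.comp y (hFd y hy)
  have hd' : ∀ y ∈ D, HasFDerivAt (fun y => (starRingEnd ℂ) (polarConnection e' z (F y) u)) _ y :=
    fun y hy => (differentiableAt_polarConnection_conj (he' _ (hFV hy)).differentiableAt
      (h0' _ (hFV hy) z hz) u).hasFDerivAt.comp y (hFd y hy)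
  refine (starRingEnd ℂ).injective (hD.eqOn_of_fderiv_eq hDc (𝕜 := ℂ)
    (f := fun y => (starRingEnd ℂ) (polarConnection e z (F y) u))
    (g := fun y => (starRingEnd ℂ) (polarConnection e' z (F y) u))
    (fun y hy => (hd y hy).differentiableAt.differentiableWithinAt)
    (fun y hy => (hd' y hy).differentiableAt.differentiableWithinAt)
    (fun y hy => ?_) ho (congrArg _ hbase) hy)
  rw [(hd y hy).fderiv, (hd' y hy).fderiv]
  ext η
  rw [ContinuousLinearMap.comp_apply, ContinuousLinearMap.comp_apply,
    fderiv_polarConnection_conj (he _ (hFV hy)).differentiableAt (h0 _ (hFV hy) z hz),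
    fderiv_polarConnection_conj (he' _ (hFV hy)).differentiableAt (h0' _ (hFV hy) z hz),
    hcurv y hy]

theorem dualInner_eq_of_polarConnection_eq (he : AnalyticOnNhd ℂ e V)
    (he' : AnalyticOnNhd ℂ e' V) (hD : IsOpen D) (hDc : IsPreconnected D)
    (hF : DifferentiableOn ℂ F D) (hFV : MapsTo F D V)
    (h0 : ∀ z ∈ V, ∀ w ∈ V, dualInner (e z) (e w) ≠ 0)
    (h0' : ∀ z ∈ V, ∀ w ∈ V, dualInner (e' z) (e' w) ≠ 0) {w : E} (hw : w ∈ V)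
    (hconn : ∀ x ∈ D, ∀ v, polarConnection e (F x) w v = polarConnection e' (F x) w v)
    (ho : o ∈ D) (hbase : dualInner (e (F o)) (e w) = dualInner (e' (F o)) (e' w))
    {x : B} (hx : x ∈ D) : dualInner (e (F x)) (e w) = dualInner (e' (F x)) (e' w) := by
  have hFd : ∀ x ∈ D, HasFDerivAt F (fderiv ℂ F x) x :=
    fun x hx => hF.hasFDerivAt (hD.mem_nhds hx)
  have hd : ∀ x ∈ D, HasFDerivAt (fun x => dualInner (e (F x)) (e w)) _ x := fun x hx =>
    (hasFDerivAt_dualInner_left (he _ (hFV hx)).differentiableAt (e w)).comp x (hFd x hx)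
  have hd' : ∀ x ∈ D, HasFDerivAt (fun x => dualInner (e' (F x)) (e' w)) _ x := fun x hx =>
    (hasFDerivAt_dualInner_left (he' _ (hFV hx)).differentiableAt (e' w)).comp x (hFd x hx)
  refine eqOn_of_smul_fderiv_eq hD hDc (f := fun x => dualInner (e (F x)) (e w))
    (g := fun x => dualInner (e' (F x)) (e' w))
    (fun x hx => (hd x hx).differentiableAt.differentiableWithinAt)
    (fun x hx => (hd' x hx).differentiableAt.differentiableWithinAt)
    (fun x hx => h0' _ (hFV hx) w hw) (fun x hx => ?_) ho hbase hx
  rw [(hd x hx).fderiv, (hd' x hx).fderiv]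
  ext η
  have hη := hconn x hx (fderiv ℂ F x η)
  rw [polarConnection, polarConnection,
    div_eq_div_iff (h0 _ (hFV hx) w hw) (h0' _ (hFV hx) w hw)] at hη
  simpa only [smul_apply, smul_eq_mul, ContinuousLinearMap.comp_apply,
    ContinuousLinearMap.flip_apply, mul_comm, dualInner] using hη

theorem oneJet_gram_eq_of_polarCurvature_eq {z w : E} (h0' : dualInner (e' z) (e' w) ≠ 0)
    (hK : dualInner (e z) (e w) = dualInner (e' z) (e' w))
    (hleft : ∀ v, polarConnection e z w v = polarConnection e' z w v)
    (hright : ∀ u, polarConnection e w z u = polarConnection e' w z u)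
    (hcurv : ∀ v u, polarCurvature e z w v u = polarCurvature e' z w v u) (ξ η : ℂ × E) :
    dualInner (oneJet e z ξ) (oneJet e w η) = dualInner (oneJet e' z ξ) (oneJet e' w η) := by
  have hl : ∀ v, dualInner (fderiv ℂ e z v) (e w) = dualInner (fderiv ℂ e' z v) (e' w) := by
    intro v
    have h := hleft v
    rwa [polarConnection, polarConnection, hK, div_left_inj' h0'] at h
  have hr : ∀ u, dualInner (e z) (fderiv ℂ e w u) = dualInner (e' z) (fderiv ℂ e' w u) := by
    intro u
    have h := congrArg (starRingEnd ℂ) (hright u)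
    rwa [polarConnection_conj, polarConnection_conj, hK, div_left_inj' h0'] at h
  have hlr : ∀ v u, dualInner (fderiv ℂ e z v) (fderiv ℂ e w u) =
      dualInner (fderiv ℂ e' z v) (fderiv ℂ e' w u) := by
    intro v u
    have h := hcurv v u
    rwa [polarCurvature, polarCurvature, hl, hr, hK, sub_left_inj, div_left_inj' h0'] at h
  simp only [oneJet_apply, dualInner_add_left, dualInner_add_right, dualInner_smul_left,
    dualInner_smul_right, hK, hl, hr, hlr]

-- Polarization gives `∂_z ∂̄_w log K = ∂_z ∂̄_w log K'` off the diagonal; this is integrated first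
-- in `w` and then in `z`, starting from the point `F o`, at which both kernels are normalized.
theorem oneJet_gram_eq_of_diagonal (he : AnalyticOnNhd ℂ e V) (he' : AnalyticOnNhd ℂ e' V)
    (hV : IsOpen V) (hD : IsOpen D) (hDc : Convex ℝ D) (hF : DifferentiableOn ℂ F D)
    (hFV : MapsTo F D V) (h0 : ∀ z ∈ V, ∀ w ∈ V, dualInner (e z) (e w) ≠ 0)
    (h0' : ∀ z ∈ V, ∀ w ∈ V, dualInner (e' z) (e' w) ≠ 0) (ho : o ∈ D)
    (hbase : ∀ z ∈ V, dualInner (e z) (e (F o)) = dualInner (e' z) (e' (F o)))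
    (hcurv : ∀ x ∈ D, ∀ v u, polarCurvature e (F x) (F x) v u = polarCurvature e' (F x) (F x) v u)
    {x y : B} (hx : x ∈ D) (hy : y ∈ D) (ξ η : ℂ × E) :
    dualInner (oneJet e (F x) ξ) (oneJet e (F y) η) =
      dualInner (oneJet e' (F x) ξ) (oneJet e' (F y) η) := by
  have hpolar : ∀ {x}, x ∈ D → ∀ {y}, y ∈ D → ∀ v u,
      polarCurvature e (F x) (F y) v u = polarCurvature e' (F x) (F y) v u := fun hx _ hy =>
    polarCurvature_eq_of_diagonal he he' hD hDc hF hFV h0 h0' hcurv hx hy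
  have hconnBase : ∀ z ∈ V, ∀ v, polarConnection e z (F o) v = polarConnection e' z (F o) v := by
    intro z hz v
    have hderiv := (hasFDerivAt_dualInner_left (he z hz).differentiableAt (e (F o))).unique
      ((hasFDerivAt_dualInner_left (he' z hz).differentiableAt (e' (F o))).congr_of_eventuallyEq
        (Filter.eventuallyEq_of_mem (hV.mem_nhds hz) hbase))
    rw [polarConnection, polarConnection, hbase z hz]
    exact congrArg (· / _) (DFunLike.congr_fun hderiv v)
  have hconn : ∀ {x}, x ∈ D → ∀ {y}, y ∈ D → ∀ v,
      polarConnection e (F x) (F y) v = polarConnection e' (F x) (F y) v := fun hx _ hy v =>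
    polarConnection_eq_of_polarCurvature_eq he he' hD hDc.isPreconnected hF hFV h0 h0' (hFV hx)
      (fun y hy u => hpolar hy hx u v) ho (hconnBase _ (hFV hx) v) hy
  have hKo : dualInner (e (F o)) (e (F y)) = dualInner (e' (F o)) (e' (F y)) := by
    rw [← dualInner_conj (e (F y)), hbase _ (hFV hy), dualInner_conj]
  have hK : dualInner (e (F x)) (e (F y)) = dualInner (e' (F x)) (e' (F y)) :=
    dualInner_eq_of_polarConnection_eq he he' hD hDc.isPreconnected hF hFV h0 h0' (hFV hy)
      (fun x hx => hconn hx hy) ho hKo hx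
  exact oneJet_gram_eq_of_polarCurvature_eq (h0' _ (hFV hx) _ (hFV hy)) hK (hconn hx hy)
    (hconn hy hx) (hpolar hx hy) ξ η

end Rigidity

section Gauge

variable {X X' : Type*} [NormedAddCommGroup X] [InnerProductSpace ℂ X] [CompleteSpace X]
  [NormedAddCommGroup X'] [InnerProductSpace ℂ X'] [CompleteSpace X']
  {E : Type*} [NormedAddCommGroup E] [NormedSpace ℂ E]
  {e : E → StrongDual ℂ X} {e' : E → StrongDual ℂ X'} {z w p : E}

theorem polarCurvature_eq_of_jetMul {ℓ k : ℂ × E →ₗ[ℂ] ℂ} (hℓ : ℓ (1, 0) ≠ 0) (hk : k (1, 0) ≠ 0)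
    (h0 : dualInner (e' z) (e' w) ≠ 0)
    (h : ∀ ξ η, dualInner (oneJet e z ξ) (oneJet e w η) =
      dualInner (oneJet e' z (jetMul ℓ ξ)) (oneJet e' w (jetMul k η))) (v u : E) :
    polarCurvature e z w v u = polarCurvature e' z w v u := by
  have hk' : (starRingEnd ℂ) (k (1, 0)) ≠ 0 := (map_ne_zero _).mpr hk
  have hK := h (1, 0) (1, 0)
  have hleft := h (0, v) (1, 0)
  have hright := h (1, 0) (0, u)
  have hboth := h (0, v) (0, u)
  simp only [oneJet_one_zero, oneJet_zero_left, oneJet_apply e', jetMul, smul_zero, map_zero,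
    add_zero, map_smul, dualInner_add_left, dualInner_add_right, dualInner_smul_left,
    dualInner_smul_right] at hK hleft hright hboth
  rw [polarCurvature, polarCurvature, hK, hleft, hright, hboth]
  field_simp
  ring

theorem polarCurvature_smul {c : E → ℂ} (hc : DifferentiableAt ℂ c z) (he : DifferentiableAt ℂ e z)
    (hcz : c z ≠ 0) (hez : e z ≠ 0) (v u : E) :
    polarCurvature (fun w => c w • e w) z z v u = polarCurvature e z z v u :=
  polarCurvature_eq_of_jetMul (ℓ := oneJet c z) (k := oneJet c z) (by simpa using hcz)
    (by simpa using hcz) (dualInner_self_ne_zero hez)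
    (fun ξ η => by rw [oneJet_smul hc he, oneJet_smul hc he]) v u

theorem exists_dualInner_ne_zero {E : Type*} [TopologicalSpace E] {e : E → StrongDual ℂ X} {p : E}
    (he : ContinuousAt e p) (h0 : e p ≠ 0) :
    ∃ V ∈ 𝓝 p, ∀ z ∈ V, ∀ w ∈ V, dualInner (e z) (e w) ≠ 0 := by
  have hcont : ContinuousAt (fun q : E × E => dualInner (e q.1) (e q.2)) (p, p) := by
    have hRiesz := (InnerProductSpace.toDual ℂ X).symm.continuous
    exact (he.comp_of_eq continuousAt_fst rfl).clm_apply
      (hRiesz.continuousAt.comp (he.comp_of_eq continuousAt_snd rfl))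
  have hev := hcont.eventually_ne (dualInner_self_ne_zero h0)
  rw [nhds_prod_eq] at hev
  exact eventually_prod_self_iff.mp hev

-- Up to the constant `‖e p‖ / ‖e' p‖`, the factor is the quotient of the two sections paired with
-- their values at `p`.
theorem exists_smul_dualInner_eq (he : AnalyticAt ℂ e p) (he' : AnalyticAt ℂ e' p) (h0 : e p ≠ 0)
    (h0' : e' p ≠ 0) : ∃ c : E → ℂ, AnalyticAt ℂ c p ∧ c p ≠ 0 ∧
      ∀ᶠ z in 𝓝 p, dualInner (e z) (e p) = dualInner (c z • e' z) (c p • e' p) := by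
  set ρ : ℝ := ‖e p‖ / ‖e' p‖ with hρ
  have hρ0 : (ρ : ℂ) ≠ 0 :=
    Complex.ofReal_ne_zero.mpr (div_ne_zero (norm_ne_zero_iff.mpr h0) (norm_ne_zero_iff.mpr h0'))
  have hp' := dualInner_self_ne_zero h0'
  have hk : AnalyticAt ℂ (fun z => dualInner (e z) (e p)) p :=
    ((ContinuousLinearMap.apply ℂ ℂ
      ((InnerProductSpace.toDual ℂ X).symm (e p))).analyticAt _).comp he
  have hk' : AnalyticAt ℂ (fun z => dualInner (e' z) (e' p)) p :=
    ((ContinuousLinearMap.apply ℂ ℂ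
      ((InnerProductSpace.toDual ℂ X').symm (e' p))).analyticAt _).comp he'
  set c : E → ℂ := fun z => dualInner (e z) (e p) / dualInner (e' z) (e' p) / ρ with hc
  have hcp : c p = ρ := by
    have hratio : dualInner (e p) (e p) / dualInner (e' p) (e' p) = (ρ : ℂ) * ρ := by
      rw [dualInner_self, dualInner_self, hρ]
      push_cast
      ring
    simp only [hc, hratio, mul_div_cancel_right₀ _ hρ0]
  refine ⟨c, (hk.div hk' hp').div analyticAt_const hρ0, hcp ▸ hρ0, ?_⟩
  filter_upwards [hk'.continuousAt.eventually_ne hp'] with z hz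
  rw [dualInner_smul_left, dualInner_smul_right, hcp, Complex.conj_ofReal, hc]
  field_simp

end Gauge

namespace IsHypersurface

variable {X X' : Type*} [NormedAddCommGroup X] [InnerProductSpace ℂ X] [CompleteSpace X]
  [NormedAddCommGroup X'] [InnerProductSpace ℂ X'] [CompleteSpace X']
  {m : ℕ} {Ω Z : Set (EuclideanSpace ℂ (Fin m))} {p : EuclideanSpace ℂ (Fin m)}
  {e : EuclideanSpace ℂ (Fin m) → StrongDual ℂ X} {e' : EuclideanSpace ℂ (Fin m) → StrongDual ℂ X'}

theorem exists_oneJet_gram_eq (hZ : IsHypersurface Ω Z) (hp : p ∈ Z) (he : AnalyticAt ℂ e p)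
    (he' : AnalyticAt ℂ e' p) (h0 : e p ≠ 0) (h0' : e' p ≠ 0)
    (hbase : ∀ᶠ z in 𝓝 p, dualInner (e z) (e p) = dualInner (e' z) (e' p))
    (hcurv : ∀ᶠ z in 𝓝[Z] p, ∀ v u, polarCurvature e z z v u = polarCurvature e' z z v u) :
    ∃ W ∈ 𝓝 p, ∀ z ∈ Z ∩ W, ∀ w ∈ Z ∩ W, ∀ ξ η,
      dualInner (oneJet e z ξ) (oneJet e w η) = dualInner (oneJet e' z ξ) (oneJet e' w η) := by
  obtain ⟨V₁, hV₁, hne⟩ := exists_dualInner_ne_zero he.continuousAt h0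
  obtain ⟨V₂, hV₂, hne'⟩ := exists_dualInner_ne_zero he'.continuousAt h0'
  obtain ⟨V, hVs, hV, hpV⟩ := eventually_nhds_iff.mp (Eventually.and hV₁ <| Eventually.and hV₂ <|
    he.eventually_analyticAt.and <| he'.eventually_analyticAt.and <|
    hbase.and <| eventually_nhdsWithin_iff.mp hcurv)
  choose hVV₁ hVV₂ heV heV' hbaseV hcurvV using hVs
  obtain ⟨U, φ, hφ, hpU⟩ := hZ.2 p hp
  obtain ⟨F, hF, hF0, hFZ, -, hFW⟩ := hφ.exists_parametrization hpU hp
  have hFV : ∀ᶠ x in 𝓝 0, F x ∈ V :=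
    hF.continuousAt.eventually_mem (hF0.symm ▸ hV.mem_nhds hpV)
  obtain ⟨ε, hε, hball⟩ := Metric.nhds_basis_ball.eventually_iff.mp
    (hF.eventually_analyticAt.and (hFZ.and hFV))
  obtain ⟨W, hW, hWF⟩ := mem_nhdsWithin_iff_exists_mem_nhds_inter.mp
    (hFW _ (Metric.ball_mem_nhds 0 hε))
  refine ⟨W, hW, ?_⟩
  rintro z ⟨hzZ, hzW⟩ w ⟨hwZ, hwW⟩
  obtain ⟨x, hx, rfl⟩ := hWF ⟨hzW, hzZ⟩
  obtain ⟨y, hy, rfl⟩ := hWF ⟨hwW, hwZ⟩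
  exact oneJet_gram_eq_of_diagonal heV heV' hV Metric.isOpen_ball (convex_ball 0 ε)
    (fun x hx => (hball hx).1.differentiableAt.differentiableWithinAt) (fun x hx => (hball hx).2.2)
    (fun z hz w hw => hne z (hVV₁ z hz) w (hVV₁ w hw))
    (fun z hz w hw => hne' z (hVV₂ z hz) w (hVV₂ w hw)) (Metric.mem_ball_self hε)
    (fun z hz => hF0.symm ▸ hbaseV z hz)
    (fun x hx => hcurvV _ (hball hx).2.2 (hball hx).2.1) hx hy

theorem exists_oneJet_gram_eq_jetMul (hZ : IsHypersurface Ω Z) (hp : p ∈ Z) (he : AnalyticAt ℂ e p)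
    (he' : AnalyticAt ℂ e' p) (h0 : e p ≠ 0) (h0' : e' p ≠ 0)
    (hcurv : ∀ᶠ z in 𝓝[Z] p, ∀ v u, polarCurvature e z z v u = polarCurvature e' z z v u) :
    ∃ c : EuclideanSpace ℂ (Fin m) → ℂ, ∃ W ∈ 𝓝 p, (∀ z ∈ W, c z ≠ 0) ∧
      ∀ z ∈ Z ∩ W, ∀ w ∈ Z ∩ W, ∀ ξ η, dualInner (oneJet e z ξ) (oneJet e w η) =
        dualInner (oneJet e' z (jetMul (oneJet c z) ξ)) (oneJet e' w (jetMul (oneJet c w) η)) := by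
  obtain ⟨c, hc, hc0, hbase⟩ := exists_smul_dualInner_eq he he' h0 h0'
  have hgauge : ∀ᶠ z in 𝓝 p, c z ≠ 0 ∧ AnalyticAt ℂ c z ∧ AnalyticAt ℂ e' z ∧ e' z ≠ 0 :=
    (hc.continuousAt.eventually_ne hc0).and <| hc.eventually_analyticAt.and <|
      he'.eventually_analyticAt.and <| he'.continuousAt.eventually_ne h0'
  obtain ⟨W, hW, hgram⟩ := hZ.exists_oneJet_gram_eq hp he (hc.smul he') h0 (smul_ne_zero hc0 h0')
    hbase (by
      filter_upwards [hcurv, hgauge.filter_mono nhdsWithin_le_nhds]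
        with z hz ⟨hcz, hcd, hed, hez⟩ v u
      exact (hz v u).trans
        (polarCurvature_smul hcd.differentiableAt hed.differentiableAt hcz hez v u).symm)
  refine ⟨c, W ∩ {z | c z ≠ 0 ∧ AnalyticAt ℂ c z ∧ AnalyticAt ℂ e' z ∧ e' z ≠ 0},
    inter_mem hW hgauge, fun z hz => hz.2.1, fun z hz w hw ξ η => ?_⟩
  rw [hgram z ⟨hz.1, hz.2.1⟩ w ⟨hw.1, hw.2.1⟩,
    ← oneJet_smul hz.2.2.2.1.differentiableAt hz.2.2.2.2.1.differentiableAt,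
    ← oneJet_smul hw.2.2.2.1.differentiableAt hw.2.2.2.2.1.differentiableAt]
  rfl

end IsHypersurface

section Unitary

variable {X X' : Type*} [NormedAddCommGroup X] [InnerProductSpace ℂ X] [CompleteSpace X]
  [NormedAddCommGroup X'] [InnerProductSpace ℂ X'] [CompleteSpace X'] {ι : Type*}

theorem denseRange_linearCombination {u : ι → X} (hu : ∀ x, (∀ i, inner ℂ (u i) x = 0) → x = 0) :
    DenseRange (Finsupp.linearCombination ℂ u) := by
  have hspan : (Submodule.span ℂ (range u)).topologicalClosure = ⊤ := by
    rw [Submodule.topologicalClosure_eq_top_iff, Submodule.eq_bot_iff]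
    exact fun x hx => hu x fun i => (Submodule.mem_orthogonal _ x).mp hx (u i)
      (Submodule.subset_span ⟨i, rfl⟩)
  rw [DenseRange, ← LinearMap.coe_range, Finsupp.range_linearCombination]
  exact Submodule.dense_iff_topologicalClosure_eq_top.mpr hspan

theorem exists_linearIsometryEquiv_of_inner_eq {u : ι → X} {u' : ι → X'}
    (hu : ∀ x, (∀ i, inner ℂ (u i) x = 0) → x = 0)
    (hu' : ∀ x, (∀ i, inner ℂ (u' i) x = 0) → x = 0)
    (h : ∀ i j, inner ℂ (u i) (u j) = inner ℂ (u' i) (u' j)) :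
    ∃ T : X ≃ₗᵢ[ℂ] X', ∀ i, T (u i) = u' i := by
  have hnorm : ∀ x : ι →₀ ℂ, ‖Finsupp.linearCombination ℂ u' (LinearEquiv.refl ℂ (ι →₀ ℂ) x)‖ =
      ‖Finsupp.linearCombination ℂ u x‖ := by
    intro x
    rw [LinearEquiv.refl_apply, norm_eq_sqrt_re_inner (𝕜 := ℂ), norm_eq_sqrt_re_inner (𝕜 := ℂ)]
    simp only [Finsupp.linearCombination_apply, Finsupp.sum, sum_inner, inner_sum,
      inner_smul_left, inner_smul_right, h]
  refine ⟨(LinearEquiv.refl ℂ (ι →₀ ℂ)).extendOfIsometry (Finsupp.linearCombination ℂ u)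
    (Finsupp.linearCombination ℂ u') (denseRange_linearCombination hu)
    (denseRange_linearCombination hu') hnorm, fun i => ?_⟩
  have hT := LinearEquiv.extendOfIsometry_eq (LinearEquiv.refl ℂ (ι →₀ ℂ))
    (Finsupp.linearCombination ℂ u) (Finsupp.linearCombination ℂ u')
    (denseRange_linearCombination hu) (denseRange_linearCombination hu') hnorm
    (Finsupp.single i 1)
  simpa using hT

theorem exists_linearIsometryEquiv_of_dualInner_eq {a : ι → StrongDual ℂ X}
    {a' : ι → StrongDual ℂ X'} (ha : ∀ x, (∀ i, a i x = 0) → x = 0)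
    (ha' : ∀ x, (∀ i, a' i x = 0) → x = 0)
    (h : ∀ i j, dualInner (a i) (a j) = dualInner (a' i) (a' j)) :
    ∃ T : X ≃ₗᵢ[ℂ] X', ∀ i x, a' i (T x) = a i x := by
  obtain ⟨T, hT⟩ := exists_linearIsometryEquiv_of_inner_eq
    (u := fun i => (InnerProductSpace.toDual ℂ X).symm (a i))
    (u' := fun i => (InnerProductSpace.toDual ℂ X').symm (a' i))
    (by simpa only [InnerProductSpace.toDual_symm_apply] using ha)
    (by simpa only [InnerProductSpace.toDual_symm_apply] using ha')
    (by simpa only [dualInner_eq_inner] using h)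
  refine ⟨T, fun i x => ?_⟩
  rw [← InnerProductSpace.toDual_symm_apply, ← hT, T.inner_map_map,
    InnerProductSpace.toDual_symm_apply]

theorem dualInner_comp_linearIsometryEquiv (T : X' ≃ₗᵢ[ℂ] X) (a b : StrongDual ℂ X) :
    dualInner (a.comp (T : X' →L[ℂ] X)) (b.comp (T : X' →L[ℂ] X)) = dualInner a b := by
  have hRiesz : (InnerProductSpace.toDual ℂ X').symm (b.comp (T : X' →L[ℂ] X)) =
      T.symm ((InnerProductSpace.toDual ℂ X).symm b) := by
    refine ext_inner_right ℂ fun x => ?_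
    rw [InnerProductSpace.toDual_symm_apply, ← T.inner_map_map, T.apply_symm_apply,
      InnerProductSpace.toDual_symm_apply]
    rfl
  rw [dualInner, dualInner, hRiesz]
  exact congrArg a (T.apply_symm_apply _)

theorem dualInner_comp_subtypeL_orthogonal {V : Submodule ℂ X} (a : StrongDual ℂ X)
    {b : StrongDual ℂ X} (hb : ∀ x ∈ V, b x = 0) :
    dualInner (a.comp Vᗮ.subtypeL) (b.comp Vᗮ.subtypeL) = dualInner a b := by
  have hmem : (InnerProductSpace.toDual ℂ X).symm b ∈ Vᗮ :=
    (Submodule.mem_orthogonal' _ _).mpr fun x hx => by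
      rw [InnerProductSpace.toDual_symm_apply, hb x hx]
  have hRiesz : (InnerProductSpace.toDual ℂ Vᗮ).symm (b.comp Vᗮ.subtypeL) = ⟨_, hmem⟩ := by
    refine ext_inner_right ℂ fun x => ?_
    rw [InnerProductSpace.toDual_symm_apply, Submodule.coe_inner,
      InnerProductSpace.toDual_symm_apply]
    rfl
  rw [dualInner, hRiesz]
  rfl

theorem apply_orthogonalProjectionOnto_orthogonal {Y : Type*} [NormedAddCommGroup Y]
    [NormedSpace ℂ Y] {V : Submodule ℂ X} (A : X →L[ℂ] Y) (hA : ∀ x ∈ V, A x = 0) (x : X) :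
    A (Vᗮ.orthogonalProjectionOnto x) = A x := by
  have hclosure : x - Vᗮ.orthogonalProjectionOnto x ∈ V.topologicalClosure := by
    rw [← Submodule.orthogonal_orthogonal_eq_closure]
    exact Vᗮ.sub_starProjection_mem_orthogonal x
  have hker : V.topologicalClosure ≤ LinearMap.ker A.toLinearMap :=
    V.topologicalClosure_minimal hA A.isClosed_ker
  have hzero : A (x - Vᗮ.orthogonalProjectionOnto x) = 0 := hker hclosure
  rw [map_sub, sub_eq_zero] at hzero
  exact hzero.symm

end Unitary

namespace QuasiFree

variable {m : ℕ} {Ω Z : Set (EuclideanSpace ℂ (Fin m))} {p z w : EuclideanSpace ℂ (Fin m)}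
  {H : Type*} [NormedAddCommGroup H] [InnerProductSpace ℂ H] [CompleteSpace H]
  {H' : Type*} [NormedAddCommGroup H'] [InnerProductSpace ℂ H'] [CompleteSpace H']
  (M : QuasiFree Ω H) (M' : QuasiFree Ω H')

theorem metric_eq : M.metric = fun w => dualInner (M.eval w) (M.eval w) := by
  ext w
  have hRiesz : ContinuousLinearMap.adjoint (M.eval w) 1 =
      (InnerProductSpace.toDual ℂ H).symm (M.eval w) := by
    refine ext_inner_right ℂ fun x => ?_
    rw [ContinuousLinearMap.adjoint_inner_left, InnerProductSpace.toDual_symm_apply]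
    simp
  rw [metric, kernel, hRiesz, dualInner]

theorem eval_ne_zero (hw : w ∈ Ω) : M.eval w ≠ 0 := by
  intro h
  have hone : M.eval w (M.emb 1) = 1 := by
    rw [eval_emb M hw, evalA_one (subset_closure hw)]
  rw [h, zero_apply] at hone
  exact zero_ne_one hone

theorem oneJet_eval_apply (hw : w ∈ interior Ω) (x : H) (ξ : ℂ × EuclideanSpace ℂ (Fin m)) :
    oneJet (fun z => M.eval z x) w ξ = oneJet M.eval w ξ x :=
  oneJet_clm_comp (ContinuousLinearMap.apply ℂ ℂ x) (M.analyticOnNhd_eval w hw).differentiableAt ξ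

theorem oneJet_eval_emb (hw : w ∈ interior Ω) (f : AlgA Ω) (ξ : ℂ × EuclideanSpace ℂ (Fin m)) :
    oneJet M.eval w ξ (M.emb f) = oneJet (fun z => evalA Ω z f) w ξ := by
  have hemb : (fun z => M.eval z (M.emb f)) =ᶠ[𝓝 w] fun z => evalA Ω z f := by
    filter_upwards [mem_interior_iff_mem_nhds.mp hw] with z hz using M.eval_emb hz f
  rw [← M.oneJet_eval_apply hw, oneJet_congr hemb]

theorem oneJet_eval_act (hw : w ∈ interior Ω) (f : AlgA Ω) (x : H)
    (ξ : ℂ × EuclideanSpace ℂ (Fin m)) :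
    oneJet M.eval w ξ (M.act f x) =
      oneJet M.eval w (jetMul (oneJet (fun z => evalA Ω z f) w) ξ) x := by
  have hact : (fun z => M.eval z (M.act f x)) =ᶠ[𝓝 w] fun z => evalA Ω z f • M.eval z x := by
    filter_upwards [mem_interior_iff_mem_nhds.mp hw] with z hz using M.eval_act hz f x
  rw [← M.oneJet_eval_apply hw, oneJet_congr hact,
    oneJet_smul (analyticOnNhd_evalA f w hw).differentiableAt
      (M.analyticOnNhd_eval_apply x w hw).differentiableAt, M.oneJet_eval_apply hw]

theorem mem_vanishing_two_iff (hZ : IsHypersurface Ω Z) {x : H} :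
    x ∈ M.vanishing Z 2 ↔ ∀ p ∈ Z, oneJet (fun z => M.eval z x) p = 0 := by
  simp only [oneJet_eq_zero_iff]
  constructor
  · intro hx p hp
    obtain ⟨U, φ, hφ, hpU⟩ := hZ.2 p hp
    obtain ⟨g, hg, hfg⟩ := hx U φ hφ
    have hφp : φ p = 0 := (hφ.zero_iff p hpU).mpr hp
    refine ⟨by rw [hfg p hpU, hφp, zero_pow two_ne_zero, zero_mul], ?_⟩
    have hloc : (fun w => M.eval w x) =ᶠ[𝓝 p] fun w => φ w ^ 2 * g w := by
      filter_upwards [hφ.isOpen.mem_nhds hpU] with z hz using hfg z hz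
    have hderiv := ((hφ.holo p hpU).differentiableAt.hasFDerivAt.pow 2).mul
      (hg p hpU).differentiableAt.hasFDerivAt
    refine (hloc.fderiv_eq.trans hderiv.fderiv).trans ?_
    ext v
    simp [hφp]
  · exact fun hx U φ hφ => hφ.exists_eq_sq_smul
      ((M.analyticOnNhd_eval_apply x).mono hφ.subset_interior) fun z hz => hx z hz.2

theorem oneJet_eval_eq_zero_of_mem_vanishing (hZ : IsHypersurface Ω Z) (hp : p ∈ Z)
    (ξ : ℂ × EuclideanSpace ℂ (Fin m)) {x : H} (hx : x ∈ M.vanishing Z 2) :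
    oneJet M.eval p ξ x = 0 := by
  rw [← M.oneJet_eval_apply (hZ.subset_interior hp), (M.mem_vanishing_two_iff hZ).mp hx p hp,
    LinearMap.zero_apply]

theorem act_mem_vanishing (hZ : IsHypersurface Ω Z) (f : AlgA Ω) {x : H}
    (hx : x ∈ M.vanishing Z 2) : M.act f x ∈ M.vanishing Z 2 := by
  refine (M.mem_vanishing_two_iff hZ).mpr fun p hp => LinearMap.ext fun ξ => ?_
  rw [M.oneJet_eval_apply (hZ.subset_interior hp), M.oneJet_eval_act (hZ.subset_interior hp),
    M.oneJet_eval_eq_zero_of_mem_vanishing hZ hp _ hx, LinearMap.zero_apply]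

/-- The evaluation at `z` on the quotient module. -/
noncomputable def quotEval (Z : Set (EuclideanSpace ℂ (Fin m))) (z : EuclideanSpace ℂ (Fin m)) :
    StrongDual ℂ (M.quot Z) :=
  (M.eval z).comp (M.quot Z).subtypeL

/-- The class in the quotient module of an element of `𝒜(Ω)`. -/
noncomputable def quotEmb (Z : Set (EuclideanSpace ℂ (Fin m))) (f : AlgA Ω) : M.quot Z :=
  (M.quot Z).orthogonalProjectionOnto (M.emb f)

theorem denseRange_quotEmb : DenseRange (M.quotEmb Z) := by
  refine DenseRange.comp (Function.Surjective.denseRange fun x => ⟨x, ?_⟩) M.emb_dense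
    (M.quot Z).orthogonalProjectionOnto.continuous
  exact Submodule.orthogonalProjectionOnto_mem_subspace_eq_self x

theorem quotAct_quotEmb (hZ : IsHypersurface Ω Z) (f g : AlgA Ω) :
    M.quotAct Z f (M.quotEmb Z g) = M.quotEmb Z (f * g) := by
  refine (apply_orthogonalProjectionOnto_orthogonal
    ((M.quot Z).orthogonalProjectionOnto ∘L M.act f) (fun x hx => ?_) (M.emb g)).trans ?_
  · exact Submodule.orthogonalProjectionOnto_orthogonal_apply_eq_zero (M.act_mem_vanishing hZ f hx)
  · rw [ContinuousLinearMap.comp_apply, act_emb, quotEmb]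

theorem analyticOnNhd_quotEval : AnalyticOnNhd ℂ (M.quotEval Z) (interior Ω) := fun p hp =>
  (((ContinuousLinearMap.compL ℂ (M.quot Z) H ℂ).flip (M.quot Z).subtypeL).analyticAt _).comp
    (M.analyticOnNhd_eval p hp)

theorem oneJet_quotEval (hp : p ∈ interior Ω) (ξ : ℂ × EuclideanSpace ℂ (Fin m)) :
    oneJet (M.quotEval Z) p ξ = (oneJet M.eval p ξ).comp (M.quot Z).subtypeL :=
  oneJet_clm_comp ((ContinuousLinearMap.compL ℂ (M.quot Z) H ℂ).flip (M.quot Z).subtypeL)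
    (M.analyticOnNhd_eval p hp).differentiableAt ξ

theorem oneJet_quotEval_orthogonalProjectionOnto (hZ : IsHypersurface Ω Z) (hp : p ∈ Z)
    (ξ : ℂ × EuclideanSpace ℂ (Fin m)) (x : H) :
    oneJet (M.quotEval Z) p ξ ((M.quot Z).orthogonalProjectionOnto x) = oneJet M.eval p ξ x := by
  rw [M.oneJet_quotEval (hZ.subset_interior hp)]
  exact apply_orthogonalProjectionOnto_orthogonal _
    (fun x hx => M.oneJet_eval_eq_zero_of_mem_vanishing hZ hp ξ hx) x

theorem oneJet_quotEval_quotAct (hZ : IsHypersurface Ω Z) (hp : p ∈ Z) (f : AlgA Ω)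
    (x : M.quot Z) (ξ : ℂ × EuclideanSpace ℂ (Fin m)) :
    oneJet (M.quotEval Z) p ξ (M.quotAct Z f x) =
      oneJet (M.quotEval Z) p (jetMul (oneJet (fun z => evalA Ω z f) p) ξ) x := by
  have hpΩ := hZ.subset_interior hp
  rw [M.oneJet_quotEval hpΩ (jetMul _ ξ)]
  exact (M.oneJet_quotEval_orthogonalProjectionOnto hZ hp ξ _).trans (M.oneJet_eval_act hpΩ f x ξ)

theorem oneJet_quotEval_quotEmb (hZ : IsHypersurface Ω Z) (hp : p ∈ Z) (f : AlgA Ω)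
    (ξ : ℂ × EuclideanSpace ℂ (Fin m)) :
    oneJet (M.quotEval Z) p ξ (M.quotEmb Z f) = oneJet (fun z => evalA Ω z f) p ξ := by
  rw [quotEmb, M.oneJet_quotEval_orthogonalProjectionOnto hZ hp,
    M.oneJet_eval_emb (hZ.subset_interior hp)]

theorem dualInner_oneJet_quotEval (hZ : IsHypersurface Ω Z) (hz : z ∈ Z) (hw : w ∈ Z)
    (ξ η : ℂ × EuclideanSpace ℂ (Fin m)) :
    dualInner (oneJet (M.quotEval Z) z ξ) (oneJet (M.quotEval Z) w η) =
      dualInner (oneJet M.eval z ξ) (oneJet M.eval w η) := by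
  rw [M.oneJet_quotEval (hZ.subset_interior hz), M.oneJet_quotEval (hZ.subset_interior hw)]
  exact dualInner_comp_subtypeL_orthogonal _
    fun x hx => M.oneJet_eval_eq_zero_of_mem_vanishing hZ hw η hx

theorem polarCurvature_quotEval (hZ : IsHypersurface Ω Z) (hp : p ∈ Z)
    (v u : EuclideanSpace ℂ (Fin m)) :
    polarCurvature (M.quotEval Z) p p v u = polarCurvature M.eval p p v u := by
  have hgram := M.dualInner_oneJet_quotEval hZ hp hp
  have hK := hgram (1, 0) (1, 0)
  have hleft := hgram (0, v) (1, 0)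
  have hright := hgram (1, 0) (0, u)
  have hboth := hgram (0, v) (0, u)
  simp only [oneJet_one_zero, oneJet_zero_left] at hK hleft hright hboth
  rw [polarCurvature, polarCurvature, hK, hleft, hright, hboth]

theorem quotEval_ne_zero (hZ : IsHypersurface Ω Z) (hp : p ∈ Z) : M.quotEval Z p ≠ 0 := by
  intro h
  have hone := M.oneJet_quotEval_quotEmb hZ hp 1 (1, 0)
  rw [oneJet_one_zero, oneJet_one_zero, evalA_one (subset_closure (hZ.1 hp)), h,
    zero_apply] at hone
  exact zero_ne_one hone

theorem eq_zero_of_oneJet_quotEval_eq_zero (hZ : IsHypersurface Ω Z) (hZc : IsPreconnected Z)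
    (hp : p ∈ Z) {x : M.quot Z} (h : ∀ᶠ z in 𝓝[Z] p, ∀ ξ, oneJet (M.quotEval Z) z ξ x = 0) :
    x = 0 := by
  have hjet : ∀ᶠ z in 𝓝[Z] p, M.eval z x = 0 ∧ fderiv ℂ (fun w => M.eval w x) z = 0 := by
    filter_upwards [h, self_mem_nhdsWithin] with z hz hzZ
    have hzΩ := hZ.subset_interior hzZ
    have hzero : oneJet (fun w => M.eval w (x : H)) z = 0 := LinearMap.ext fun ξ => by
      rw [M.oneJet_eval_apply hzΩ, LinearMap.zero_apply, ← hz ξ, M.oneJet_quotEval hzΩ]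
      rfl
    exact oneJet_eq_zero_iff.mp hzero
  have hx := M.analyticOnNhd_eval_apply (x : H)
  have hval := hZ.eqOn_zero_of_isPreconnected hZc hx hp (hjet.mono fun z hz => hz.1)
  have hderiv := hZ.eqOn_zero_of_isPreconnected hZc hx.fderiv hp (hjet.mono fun z hz => hz.2)
  have hmem : (x : H) ∈ M.vanishing Z 2 := (M.mem_vanishing_two_iff hZ).mpr fun z hz =>
    oneJet_eq_zero_iff.mpr ⟨hval hz, hderiv hz⟩
  exact Subtype.ext (inner_self_eq_zero.mp ((Submodule.mem_orthogonal _ _).mp x.2 x hmem))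

variable {M M'}

-- With `q` the class of `1` in the quotient of `M'`, a module map satisfies
-- `T.symm (f • q) = f • T.symm q`; so `ℓ` is the jet of the element `T.symm q`, and the elements
-- `f • q` are dense.
theorem oneJet_quotEval_comp_symm (hZ : IsHypersurface Ω Z) (hp : p ∈ Z)
    (T : M.quot Z ≃ₗᵢ[ℂ] M'.quot Z)
    (hT : ∀ (f : AlgA Ω) (x : M.quot Z), T (M.quotAct Z f x) = M'.quotAct Z f (T x)) :
    ∃ ℓ : ℂ × EuclideanSpace ℂ (Fin m) →ₗ[ℂ] ℂ, ∀ ξ,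
      (oneJet (M.quotEval Z) p ξ).comp (T.symm : M'.quot Z →L[ℂ] M.quot Z) =
        oneJet (M'.quotEval Z) p (jetMul ℓ ξ) := by
  set q : M.quot Z := T.symm (M'.quotEmb Z 1)
  refine ⟨(ContinuousLinearMap.apply ℂ ℂ q).toLinearMap ∘ₗ oneJet (M.quotEval Z) p, fun ξ => ?_⟩
  refine ContinuousLinearMap.ext fun x => M'.denseRange_quotEmb.induction_on x
    (isClosed_eq (by fun_prop) (by fun_prop)) fun f => ?_
  have hf : T.symm (M'.quotEmb Z f) = M.quotAct Z f q := by
    rw [T.symm_apply_eq, hT, T.apply_symm_apply, M'.quotAct_quotEmb hZ, mul_one]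
  rw [M'.oneJet_quotEval_quotEmb hZ hp, jetMul_apply_swap]
  exact (congrArg (oneJet (M.quotEval Z) p ξ) hf).trans (M.oneJet_quotEval_quotAct hZ hp f q ξ)

theorem polarCurvature_eq_of_quotIso (hZ : IsHypersurface Ω Z) (hiso : M.QuotIso M' Z) (hp : p ∈ Z)
    (v u : EuclideanSpace ℂ (Fin m)) :
    polarCurvature M.eval p p v u = polarCurvature M'.eval p p v u := by
  obtain ⟨T, hT⟩ := hiso
  obtain ⟨ℓ, hℓ⟩ := oneJet_quotEval_comp_symm hZ hp T hT
  have hℓ0 : ℓ (1, 0) ≠ 0 := by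
    intro h0
    have hzero := hℓ (1, 0)
    rw [oneJet_one_zero, jetMul, h0, zero_smul, Prod.mk_zero_zero, map_zero] at hzero
    refine M.quotEval_ne_zero hZ hp (ContinuousLinearMap.ext fun x => ?_)
    simpa using DFunLike.congr_fun hzero (T x)
  rw [← M.polarCurvature_quotEval hZ hp, ← M'.polarCurvature_quotEval hZ hp]
  refine polarCurvature_eq_of_jetMul hℓ0 hℓ0
    (dualInner_self_ne_zero (M'.quotEval_ne_zero hZ hp)) (fun ξ η => ?_) v u
  rw [← hℓ, ← hℓ, dualInner_comp_linearIsometryEquiv]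

theorem quotIso_of_polarCurvature_eq (hZ : IsHypersurface Ω Z) (hZc : IsConnected Z)
    (hcurv : ∀ p ∈ Z, ∀ v u, polarCurvature M.eval p p v u = polarCurvature M'.eval p p v u) :
    M.QuotIso M' Z := by
  obtain ⟨p, hp⟩ := hZc.nonempty
  have hpΩ := hZ.subset_interior hp
  obtain ⟨c, W, hW, hc, hgram⟩ := hZ.exists_oneJet_gram_eq_jetMul hp
    (M.analyticOnNhd_quotEval p hpΩ) (M'.analyticOnNhd_quotEval p hpΩ)
    (M.quotEval_ne_zero hZ hp) (M'.quotEval_ne_zero hZ hp) (by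
      filter_upwards [self_mem_nhdsWithin] with z hz v u
      rw [M.polarCurvature_quotEval hZ hz, M'.polarCurvature_quotEval hZ hz, hcurv z hz])
  have hZW : Z ∩ W ∈ 𝓝[Z] p := inter_mem self_mem_nhdsWithin (mem_nhdsWithin_of_mem_nhds hW)
  let a : ↥(Z ∩ W) × (ℂ × EuclideanSpace ℂ (Fin m)) → StrongDual ℂ (M.quot Z) :=
    fun i => oneJet (M.quotEval Z) i.1 i.2
  let a' : ↥(Z ∩ W) × (ℂ × EuclideanSpace ℂ (Fin m)) → StrongDual ℂ (M'.quot Z) :=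
    fun i => oneJet (M'.quotEval Z) i.1 (jetMul (oneJet c i.1) i.2)
  have htotal : ∀ x, (∀ i, a i x = 0) → x = 0 := fun x hx =>
    M.eq_zero_of_oneJet_quotEval_eq_zero hZ hZc.isPreconnected hp
      (Filter.mem_of_superset hZW fun z hz ξ => hx (⟨z, hz⟩, ξ))
  have htotal' : ∀ x, (∀ i, a' i x = 0) → x = 0 := fun x hx =>
    M'.eq_zero_of_oneJet_quotEval_eq_zero hZ hZc.isPreconnected hp
      (Filter.mem_of_superset hZW fun z hz ξ => by
        have hcz : oneJet c z (1, 0) ≠ 0 := by simpa using hc z hz.2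
        obtain ⟨η, rfl⟩ := jetMul_surjective hcz ξ
        exact hx (⟨z, hz⟩, η))
  obtain ⟨T, hT⟩ := exists_linearIsometryEquiv_of_dualInner_eq htotal htotal'
    fun i j => hgram i.1 i.1.2 j.1 j.1.2 i.2 j.2
  refine ⟨T, fun f x => sub_eq_zero.mp (htotal' _ fun ⟨z, ξ⟩ => ?_)⟩
  rw [map_sub, hT, sub_eq_zero]
  change oneJet (M.quotEval Z) z ξ (M.quotAct Z f x) =
    oneJet (M'.quotEval Z) z (jetMul (oneJet c z) ξ) (M'.quotAct Z f (T x))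
  rw [M.oneJet_quotEval_quotAct hZ z.2.1, M'.oneJet_quotEval_quotAct hZ z.2.1, jetMul_comm]
  exact (hT (z, jetMul (oneJet (fun z => evalA Ω z f) z) ξ) x).symm

end QuasiFree

section SecondFundamentalForm

open scoped ComplexOrder

theorem fiberInner_apply (N : Matrix (Fin 2) (Fin 2) ℂ) (a b : Fin 2 → ℂ) :
    fiberInner N a b = (starRingEnd ℂ) (b 0) * (N 0 0 * a 0 + N 0 1 * a 1) +
      (starRingEnd ℂ) (b 1) * (N 1 0 * a 0 + N 1 1 * a 1) := by
  simp [fiberInner, dotProduct, Fin.sum_univ_two, Matrix.mulVec]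

theorem gramSchmidt₁_eq (N : Matrix (Fin 2) (Fin 2) ℂ) :
    gramSchmidt₁ N = ![((√(N 0 0).re)⁻¹ : ℂ), 0] := by
  simp [gramSchmidt₁, fiberNorm, fiberInner_apply]

theorem fiberInner_gramSchmidt₁ (N : Matrix (Fin 2) (Fin 2) ℂ) (a : Fin 2 → ℂ) :
    fiberInner N a (gramSchmidt₁ N) = (√(N 0 0).re : ℂ)⁻¹ * N.mulVec a 0 := by
  simp [fiberInner, gramSchmidt₁_eq, dotProduct, Fin.sum_univ_two]

theorem gramSchmidt₂_eq {N : Matrix (Fin 2) (Fin 2) ℂ} (hN : 0 < N 0 0) :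
    gramSchmidt₂ N = (√(N.det / N 0 0).re : ℂ)⁻¹ • ![-((N 0 0)⁻¹ * N 0 1), 1] := by
  obtain ⟨a, ha, h00⟩ := RCLike.pos_iff_exists_ofReal.mp hN
  replace h00 : N 0 0 = (a : ℂ) := h00.symm
  have ha0 : (a : ℂ) ≠ 0 := mod_cast ha.ne'
  have hproj : (![0, 1] - fiberInner N ![0, 1] (gramSchmidt₁ N) • gramSchmidt₁ N : Fin 2 → ℂ) =
      ![-((N 0 0)⁻¹ * N 0 1), 1] := by
    have hsqrt : (√a : ℂ)⁻¹ * (√a : ℂ)⁻¹ = (a : ℂ)⁻¹ := by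
      rw [← mul_inv]
      exact_mod_cast congrArg _ (Real.mul_self_sqrt ha.le)
    rw [fiberInner_gramSchmidt₁, gramSchmidt₁_eq, h00, ← hsqrt]
    ext i
    fin_cases i <;> simp [Matrix.mulVec, dotProduct, Fin.sum_univ_two, mul_right_comm]
  have hnorm : fiberInner N ![-((N 0 0)⁻¹ * N 0 1), 1] ![-((N 0 0)⁻¹ * N 0 1), 1] =
      N.det / N 0 0 := by
    simp only [fiberInner_apply, Matrix.det_fin_two, h00, Matrix.cons_val_zero,
      Matrix.cons_val_one, map_one]
    field_simp
    ring
  simp only [gramSchmidt₂, hproj, fiberNorm, hnorm]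

variable {m : ℕ} {z : EuclideanSpace ℂ (Fin m)}

theorem mulVec_chernD {N : EuclideanSpace ℂ (Fin m) → Matrix (Fin 2) (Fin 2) ℂ}
    {σ : EuclideanSpace ℂ (Fin m) → Fin 2 → ℂ} {i : Fin 2}
    (hN : ∀ j, DifferentiableAt ℝ (fun w => N w i j) z) (hσ : DifferentiableAt ℝ σ z)
    (hdet : IsUnit (N z).det) (v : EuclideanSpace ℂ (Fin m)) :
    (N z).mulVec (chernD N σ z v) i =
      dHol (fun w => (N w).mulVec (σ w) i) z v + (N z).mulVec (dBar σ z v) i := by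
  have hσj : ∀ j, DifferentiableAt ℝ (fun w => σ w j) z := differentiableAt_pi.mp hσ
  have hleibniz : dHol (fun w => (N w).mulVec (σ w) i) z v = (N z).mulVec (dHol σ z v) i +
      (Matrix.of fun i j => dHol (fun w => N w i j) z v).mulVec (σ z) i := by
    simp only [Matrix.mulVec, dotProduct, Fin.sum_univ_two, dHol, Matrix.of_apply,
      fderiv_fun_add ((hN 0).fun_mul (hσj 0)) ((hN 1).fun_mul (hσj 1)),
      fderiv_fun_mul (hN _) (hσj _), fderiv_apply hσ]
    simp only [add_apply, smul_apply, smul_eq_mul, ContinuousLinearMap.comp_apply,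
      ContinuousLinearMap.proj_apply, Pi.smul_apply, Pi.sub_apply]
    ring
  rw [chernD, Matrix.mulVec_add, Matrix.mulVec_add, Matrix.mulVec_mulVec, ← Matrix.mul_assoc,
    Matrix.mul_nonsing_inv _ hdet, Matrix.one_mul, hleibniz]
  rfl

theorem differentiableAt_inv_sqrt_re {E : Type*} [NormedAddCommGroup E] [NormedSpace ℝ E]
    {f : E → ℂ} {z : E} (hf : DifferentiableAt ℝ f z) (hpos : 0 < (f z).re) :
    DifferentiableAt ℝ (fun w => (√(f w).re : ℂ)⁻¹) z := by
  have hre : DifferentiableAt ℝ (fun w => (f w).re) z := Complex.reCLM.differentiableAt.comp z hf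
  have hsqrt : DifferentiableAt ℝ (fun w => (√(f w).re : ℂ)) z :=
    Complex.ofRealCLM.differentiableAt.comp z (hre.sqrt hpos.ne')
  exact (hasFDerivAt_inv_of_ne_zero hsqrt.hasFDerivAt
    (mod_cast (Real.sqrt_pos.mpr hpos).ne')).differentiableAt

-- The section `s • (-q, 1)` is orthogonal to the first frame vector everywhere, so that only its
-- `∂̄` derivative counts, in which the terms containing `∂̄ s` cancel.
theorem mulVec_chernD_smul_of_orthogonal
    {N : EuclideanSpace ℂ (Fin m) → Matrix (Fin 2) (Fin 2) ℂ} {s q : EuclideanSpace ℂ (Fin m) → ℂ}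
    (hN : ∀ j, DifferentiableAt ℝ (fun w => N w 0 j) z) (hdet : IsUnit (N z).det)
    (hs : DifferentiableAt ℝ s z) (hq : DifferentiableAt ℝ q z)
    (horth : ∀ᶠ w in 𝓝 z, N w 0 1 = N w 0 0 * q w) (v : EuclideanSpace ℂ (Fin m)) :
    (N z).mulVec (chernD N (fun w => s w • ![-q w, 1]) z v) 0 =
      -(N z 0 0 * s z) * dBar q z v := by
  have hσ : DifferentiableAt ℝ (fun w => s w • ![-q w, 1]) z := by
    refine differentiableAt_pi.mpr fun i => ?_
    fin_cases i
    · simpa using (hs.fun_mul hq).neg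
    · simpa using hs
  have hzero : (fun w => (N w).mulVec (s w • ![-q w, 1]) 0) =ᶠ[𝓝 z] fun _ => 0 := by
    filter_upwards [horth] with w hw
    simp only [Matrix.mulVec, dotProduct, Fin.sum_univ_two, hw, Pi.smul_apply, smul_eq_mul,
      Matrix.cons_val_zero, Matrix.cons_val_one]
    ring
  have hbar₀ : dBar (fun w => s w • ![-q w, 1]) z v 0 = -(s z * dBar q z v + q z * dBar s z v) := by
    have hcomp : (fun w => (s w • ![-q w, 1]) 0) = fun w => -(s w * q w) := by
      ext w
      simp
    rw [dBar_apply hσ, hcomp, dBar_neg, dBar_mul hs hq]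
  have hbar₁ : dBar (fun w => s w • ![-q w, 1]) z v 1 = dBar s z v := by
    have hcomp : (fun w => (s w • ![-q w, 1]) 1) = s := by
      ext w
      simp
    rw [dBar_apply hσ, hcomp]
  rw [mulVec_chernD hN hσ hdet, dHol_congr hzero, Matrix.mulVec, dotProduct, Fin.sum_univ_two,
    hbar₀, hbar₁, horth.self_of_nhds]
  simp only [dHol, fderiv_fun_const, Pi.zero_apply, zero_apply, smul_zero, sub_zero]
  ring

theorem fiberInner_chernD_gramSchmidt₂
    {N : EuclideanSpace ℂ (Fin m) → Matrix (Fin 2) (Fin 2) ℂ}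
    (hN : ∀ i j, DifferentiableAt ℝ (fun w => N w i j) z) (hpos : ∀ᶠ w in 𝓝 z, 0 < N w 0 0)
    (hdet : 0 < (N z).det) (v : EuclideanSpace ℂ (Fin m)) :
    fiberInner (N z) (chernD N (fun w => gramSchmidt₂ (N w)) z v) (gramSchmidt₁ (N z)) =
      -(N z 0 0 / √(N z).det.re) * dBar (fun w => (N w 0 0)⁻¹ * N w 0 1) z v := by
  obtain ⟨a, ha, h00⟩ := RCLike.pos_iff_exists_ofReal.mp hpos.self_of_nhds
  obtain ⟨d, hd, hNd⟩ := RCLike.pos_iff_exists_ofReal.mp hdet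
  replace h00 : N z 0 0 = (a : ℂ) := h00.symm
  replace hNd : (N z).det = (d : ℂ) := hNd.symm
  have hinv : DifferentiableAt ℝ (fun w => (N w 0 0)⁻¹) z :=
    (hasFDerivAt_inv_of_ne_zero (hN 0 0).hasFDerivAt hpos.self_of_nhds.ne').differentiableAt
  have hschur : (N z).det / N z 0 0 = ((d / a : ℝ) : ℂ) := by
    rw [hNd, h00, Complex.ofReal_div]
  have hs : DifferentiableAt ℝ (fun w => (√((N w).det / N w 0 0).re : ℂ)⁻¹) z := by
    refine differentiableAt_inv_sqrt_re ?_ (by rw [hschur]; exact div_pos hd ha)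
    simp only [Matrix.det_fin_two, div_eq_mul_inv]
    exact (((hN 0 0).mul (hN 1 1)).sub ((hN 0 1).mul (hN 1 0))).mul hinv
  have hframe : (fun w => gramSchmidt₂ (N w)) =ᶠ[𝓝 z]
      fun w => (√((N w).det / N w 0 0).re : ℂ)⁻¹ • ![-((N w 0 0)⁻¹ * N w 0 1), 1] := by
    filter_upwards [hpos] with w hw using gramSchmidt₂_eq hw
  have hchern : chernD N (fun w => gramSchmidt₂ (N w)) z v = chernD N
      (fun w => (√((N w).det / N w 0 0).re : ℂ)⁻¹ • ![-((N w 0 0)⁻¹ * N w 0 1), 1]) z v := by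
    rw [chernD, chernD, dHol_congr hframe, dBar_congr hframe, gramSchmidt₂_eq hpos.self_of_nhds]
  have hq : DifferentiableAt ℝ (fun w => (N w 0 0)⁻¹ * N w 0 1) z := hinv.fun_mul (hN 0 1)
  rw [hchern, fiberInner_gramSchmidt₁, mulVec_chernD_smul_of_orthogonal (hN 0) hdet.ne'.isUnit hs
    hq (hpos.mono fun w hw => (mul_inv_cancel_left₀ hw.ne' _).symm), hschur, hNd,
    h00, Complex.ofReal_re, Complex.ofReal_re, Complex.ofReal_re, Real.sqrt_div hd.le]
  have hsqrt : (√a : ℂ) ≠ 0 := mod_cast (Real.sqrt_pos.mpr ha).ne'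
  push_cast
  field_simp

end SecondFundamentalForm

section JetMetric

open scoped ComplexOrder

variable {X : Type*} [NormedAddCommGroup X] [InnerProductSpace ℂ X] [CompleteSpace X]

theorem dualInner_self_sub_proj (a : StrongDual ℂ X) {b : StrongDual ℂ X} (hb : b ≠ 0) :
    dualInner a a - dualInner a b * dualInner b a / dualInner b b =
      ((‖a - (dualInner a b / dualInner b b) • b‖ ^ 2 : ℝ) : ℂ) := by
  have hbb := dualInner_self_ne_zero hb
  rw [← dualInner_self]
  simp only [dualInner_sub_left, dualInner_sub_right, dualInner_smul_left, dualInner_smul_right,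
    map_div₀, dualInner_conj]
  field_simp
  ring

theorem polarCurvature_self_pos {E : Type*} [NormedAddCommGroup E] [NormedSpace ℂ E]
    {e : E → StrongDual ℂ X} {p v : E} (he0 : e p ≠ 0) (hv : ∀ c : ℂ, fderiv ℂ e p v ≠ c • e p) :
    0 < polarCurvature e p p v v := by
  have hee := dualInner_self_ne_zero he0
  have hsq := dualInner_self_sub_proj (fderiv ℂ e p v) he0
  set r := ‖fderiv ℂ e p v - (dualInner (fderiv ℂ e p v) (e p) / dualInner (e p) (e p)) • e p‖
  have hr : 0 < r := norm_pos_iff.mpr (sub_ne_zero.mpr (hv _))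
  have hcurv : polarCurvature e p p v v = ((r ^ 2 / ‖e p‖ ^ 2 : ℝ) : ℂ) := by
    rw [Complex.ofReal_div, ← hsq, ← dualInner_self, polarCurvature]
    field_simp
  rw [hcurv]
  exact_mod_cast div_pos (pow_pos hr 2) (pow_pos (norm_pos_iff.mpr he0) 2)

variable {m : ℕ} {e : EuclideanSpace ℂ (Fin m) → StrongDual ℂ X}
  {ν : EuclideanSpace ℂ (Fin m) → EuclideanSpace ℂ (Fin m)} {p : EuclideanSpace ℂ (Fin m)}

theorem jetMetric_dualInner (he : AnalyticAt ℂ e p) (hν : DifferentiableAt ℂ ν p) :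
    jetMetric ν (fun w => dualInner (e w) (e w)) p =
      !![dualInner (e p) (e p), dualInner (fderiv ℂ e p (ν p)) (e p);
        dualInner (e p) (fderiv ℂ e p (ν p)),
        dualInner (fderiv ℂ e p (ν p)) (fderiv ℂ e p (ν p))] := by
  rw [jetMetric, dBar_congr (eventuallyEq_dHol_dualInner_self he ν),
    dHol_dualInner he.differentiableAt he.differentiableAt,
    dBar_dualInner he.differentiableAt he.differentiableAt,
    dBar_dualInner (he.fderiv.differentiableAt.clm_apply hν) he.differentiableAt]

theorem det_jetMetric_dualInner (he : AnalyticAt ℂ e p) (hν : DifferentiableAt ℂ ν p)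
    (he0 : e p ≠ 0) : (jetMetric ν (fun w => dualInner (e w) (e w)) p).det =
      ((‖e p‖ ^ 2 : ℝ) : ℂ) ^ 2 * polarCurvature e p p (ν p) (ν p) := by
  have hee := dualInner_self_ne_zero he0
  rw [jetMetric_dualInner he hν, Matrix.det_fin_two_of, ← dualInner_self, polarCurvature]
  field_simp

theorem differentiableAt_jetMetric_dualInner (he : AnalyticAt ℂ e p) (hν : AnalyticAt ℂ ν p)
    (i j : Fin 2) :
    DifferentiableAt ℝ (fun w => jetMetric ν (fun w => dualInner (e w) (e w)) w i j) p := by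
  have hgram : (fun w => jetMetric ν (fun w => dualInner (e w) (e w)) w i j) =ᶠ[𝓝 p]
      fun w => dualInner (![e w, fderiv ℂ e w (ν w)] j) (![e w, fderiv ℂ e w (ν w)] i) := by
    filter_upwards [he.eventually_analyticAt, hν.eventually_analyticAt] with w he hν
    rw [jetMetric_dualInner he hν.differentiableAt]
    fin_cases i <;> fin_cases j <;> rfl
  have hframe : ∀ k, DifferentiableAt ℂ (fun w => ![e w, fderiv ℂ e w (ν w)] k) p :=
    Fin.forall_fin_two.mpr
      ⟨he.differentiableAt, he.fderiv.differentiableAt.clm_apply hν.differentiableAt⟩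
  exact (differentiableAt_real_dualInner (hframe j) (hframe i)).congr_of_eventuallyEq hgram

theorem secondFundamentalForm_dualInner (he : AnalyticAt ℂ e p) (hν : AnalyticAt ℂ ν p)
    (he0 : e p ≠ 0) (hpos : 0 < polarCurvature e p p (ν p) (ν p)) (v : EuclideanSpace ℂ (Fin m)) :
    secondFundamentalForm ν (fun w => dualInner (e w) (e w)) p v =
      -(√(polarCurvature e p p (ν p) (ν p)).re : ℂ)⁻¹ * polarCurvature e p p (ν p) v := by
  set N := jetMetric ν (fun w => dualInner (e w) (e w))
  have hnorm : 0 < ‖e p‖ := norm_pos_iff.mpr he0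
  have hN₀₀ : ∀ᶠ w in 𝓝 p, 0 < N w 0 0 := by
    filter_upwards [he.continuousAt.eventually_ne he0] with w hw
    change 0 < dualInner (e w) (e w)
    rw [dualInner_self]
    exact_mod_cast pow_pos (norm_pos_iff.mpr hw) 2
  have hdet := det_jetMetric_dualInner he hν.differentiableAt he0
  have hdet_pos : 0 < (N p).det := by
    rw [hdet]
    exact mul_pos (mod_cast pow_pos (pow_pos hnorm 2) 2) hpos
  have hsqrt : √(N p).det.re = ‖e p‖ ^ 2 * √(polarCurvature e p p (ν p) (ν p)).re := by
    rw [hdet, ← Complex.ofReal_pow, Complex.re_ofReal_mul, Real.sqrt_mul (by positivity),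
      Real.sqrt_sq (by positivity)]
  have hconn : (fun w => (N w 0 0)⁻¹ * N w 0 1) =ᶠ[𝓝 p]
      fun w => (dualInner (e w) (e w))⁻¹ * dualInner (fderiv ℂ e w (ν w)) (e w) :=
    EventuallyEq.rfl.mul (eventuallyEq_dHol_dualInner_self he ν)
  have hcurv : dBar (fun w => (N w 0 0)⁻¹ * N w 0 1) p v = polarCurvature e p p (ν p) v :=
    (dBar_congr hconn v).trans (dBar_inv_mul_dualInner he.differentiableAt
      (he.fderiv.differentiableAt.clm_apply hν.differentiableAt) he0 v)
  have hratio : N p 0 0 / √(N p).det.re = (√(polarCurvature e p p (ν p) (ν p)).re : ℂ)⁻¹ := by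
    rw [hsqrt]
    change dualInner (e p) (e p) / _ = _
    have hnorm' : (‖e p‖ : ℂ) ≠ 0 := mod_cast hnorm.ne'
    rw [dualInner_self]
    push_cast
    field_simp
  rw [secondFundamentalForm, fiberInner_chernD_gramSchmidt₂
    (differentiableAt_jetMetric_dualInner he hν) hN₀₀ hdet_pos, hcurv, hratio]

end JetMetric

section Invariants

open scoped ComplexOrder

variable {m : ℕ} {Ω Z : Set (EuclideanSpace ℂ (Fin m))} {p n : EuclideanSpace ℂ (Fin m)}

theorem IsHypersurface.exists_eq_tangent_add_smul (hZ : IsHypersurface Ω Z) (hp : p ∈ Z)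
    (hn : n ∉ tangentZ Ω Z p) (v : EuclideanSpace ℂ (Fin m)) :
    ∃ t ∈ tangentZ Ω Z p, ∃ c : ℂ, v = t + c • n := by
  obtain ⟨U, φ, hφ, hpU⟩ := hZ.2 p hp
  rw [hφ.mem_tangentZ_iff hpU hp] at hn
  refine ⟨v - (fderiv ℂ φ p v / fderiv ℂ φ p n) • n, ?_, fderiv ℂ φ p v / fderiv ℂ φ p n,
    by abel⟩
  rw [hφ.mem_tangentZ_iff hpU hp, map_sub, map_smul, smul_eq_mul, div_mul_cancel₀ _ hn, sub_self]

namespace QuasiFree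

variable {H : Type*} [NormedAddCommGroup H] [InnerProductSpace ℂ H] [CompleteSpace H]
  {H' : Type*} [NormedAddCommGroup H'] [InnerProductSpace ℂ H'] [CompleteSpace H']
  (M : QuasiFree Ω H) (M' : QuasiFree Ω H')

theorem curvature_metric (hp : p ∈ interior Ω) (u v : EuclideanSpace ℂ (Fin m)) :
    curvature M.metric p u v = polarCurvature M.eval p p v u := by
  rw [metric_eq]
  exact curvature_dualInner (M.analyticOnNhd_eval p hp) (M.eval_ne_zero (interior_subset hp)) u v

-- Testing `e' = c • e` on the constant `1` gives `c = 0`, and then on linear functions `v = 0`.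
theorem polarCurvature_eval_self_pos (hp : p ∈ interior Ω) {v : EuclideanSpace ℂ (Fin m)}
    (hv : v ≠ 0) : 0 < polarCurvature M.eval p p v v := by
  refine polarCurvature_self_pos (M.eval_ne_zero (interior_subset hp)) fun c hc => ?_
  have hderiv : ∀ f : AlgA Ω, fderiv ℂ (fun z => evalA Ω z f) p v = c * evalA Ω p f := by
    intro f
    rw [← oneJet_zero_left, ← M.oneJet_eval_emb hp, oneJet_zero_left, hc, smul_apply, smul_eq_mul,
      M.eval_emb (interior_subset hp)]
  have hclosure : ∀ᶠ z in 𝓝 p, z ∈ closure Ω := by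
    filter_upwards [mem_interior_iff_mem_nhds.mp hp] with z hz using subset_closure hz
  have hone : (fun z => evalA Ω z 1) =ᶠ[𝓝 p] fun _ => (1 : ℂ) :=
    hclosure.mono fun z hz => evalA_one hz
  have hlinear : (fun z => evalA Ω z (AlgA.ofDual Ω (innerSL ℂ v))) =ᶠ[𝓝 p] innerSL ℂ v :=
    hclosure.mono fun z hz => evalA_ofDual hz _
  have hc0 : 0 = c := by
    simpa [hone.fderiv_eq, evalA_one hclosure.self_of_nhds] using hderiv 1
  have hvv := hderiv (AlgA.ofDual Ω (innerSL ℂ v))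
  rw [hlinear.fderiv_eq, ContinuousLinearMap.fderiv, ← hc0, zero_mul, innerSL_apply_apply] at hvv
  exact hv (inner_self_eq_zero.mp hvv)

theorem secondFundamentalForm_metric (hp : p ∈ interior Ω)
    {ν : EuclideanSpace ℂ (Fin m) → EuclideanSpace ℂ (Fin m)} (hν : AnalyticAt ℂ ν p)
    (hν0 : ν p ≠ 0) (v : EuclideanSpace ℂ (Fin m)) :
    secondFundamentalForm ν M.metric p v =
      -(√(curvTrans M.metric p (ν p)).re : ℂ)⁻¹ * curvature M.metric p v (ν p) := by
  rw [curvTrans, curvature_metric M hp, curvature_metric M hp, metric_eq]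
  exact secondFundamentalForm_dualInner (M.analyticOnNhd_eval p hp) hν
    (M.eval_ne_zero (interior_subset hp)) (M.polarCurvature_eval_self_pos hp hν0) v

theorem curvature_metric_conj (hp : p ∈ interior Ω) (u v : EuclideanSpace ℂ (Fin m)) :
    (starRingEnd ℂ) (curvature M.metric p u v) = curvature M.metric p v u := by
  rw [curvature_metric M hp, curvature_metric M hp, polarCurvature_conj]

variable {M M'}

theorem curvature_metric_eq_iff (hZ : IsHypersurface Ω Z) (hp : p ∈ Z) (hn : n ∉ tangentZ Ω Z p) :
    (∀ u v, curvature M.metric p u v = curvature M'.metric p u v) ↔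
      curvTan Ω Z M.metric p = curvTan Ω Z M'.metric p ∧
      curvTrans M.metric p n = curvTrans M'.metric p n ∧
      curvOff Ω Z M.metric p n = curvOff Ω Z M'.metric p n := by
  have hpΩ := hZ.subset_interior hp
  refine ⟨fun h => ⟨funext₂ fun u v => h u v, h n n, funext fun v => h n v⟩, ?_⟩
  rintro ⟨htan, htrans, hoff⟩ u v
  obtain ⟨s, hs, d, rfl⟩ := hZ.exists_eq_tangent_add_smul hp hn u
  obtain ⟨t, ht, c, rfl⟩ := hZ.exists_eq_tangent_add_smul hp hn v
  have hst : curvature M.metric p s t = curvature M'.metric p s t :=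
    congrFun₂ htan ⟨s, hs⟩ ⟨t, ht⟩
  have hnn : curvature M.metric p n n = curvature M'.metric p n n := htrans
  have hnt : curvature M.metric p n t = curvature M'.metric p n t := congrFun hoff ⟨t, ht⟩
  have hsn : curvature M.metric p s n = curvature M'.metric p s n := by
    rw [← M.curvature_metric_conj hpΩ, ← M'.curvature_metric_conj hpΩ]
    exact congrArg _ (congrFun hoff ⟨s, hs⟩)
  simp only [M.curvature_metric hpΩ, M'.curvature_metric hpΩ] at hst hnn hnt hsn ⊢
  simp only [polarCurvature_add_left, polarCurvature_add_right, polarCurvature_smul_left,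
    polarCurvature_smul_right, hst, hnn, hnt, hsn]

theorem secondFundamentalForm_metric_eq_iff (hp : p ∈ interior Ω)
    {ν : EuclideanSpace ℂ (Fin m) → EuclideanSpace ℂ (Fin m)} (hν : AnalyticAt ℂ ν p)
    (hν0 : ν p ≠ 0) (htrans : curvTrans M.metric p (ν p) = curvTrans M'.metric p (ν p)) :
    secondFundamentalForm ν M.metric p = secondFundamentalForm ν M'.metric p ↔
      ∀ v, curvature M.metric p (ν p) v = curvature M'.metric p (ν p) v := by
  have hscale : -(√(curvTrans M.metric p (ν p)).re : ℂ)⁻¹ ≠ 0 := by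
    have hpos := M.polarCurvature_eval_self_pos hp hν0
    rw [← M.curvature_metric hp] at hpos
    exact neg_ne_zero.mpr (inv_ne_zero
      (mod_cast (Real.sqrt_pos.mpr (Complex.pos_iff.mp hpos).1).ne'))
  rw [funext_iff]
  refine forall_congr' fun v => ?_
  rw [M.secondFundamentalForm_metric hp hν hν0, M'.secondFundamentalForm_metric hp hν hν0,
    ← htrans, mul_right_inj' hscale, ← M.curvature_metric_conj hp (ν p),
    ← M'.curvature_metric_conj hp (ν p), (starRingEnd ℂ).injective.eq_iff]

theorem quotIso_iff_curvature_eq (hZ : IsHypersurface Ω Z) (hZc : IsConnected Z) :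
    M.QuotIso M' Z ↔ ∀ p ∈ Z, ∀ u v, curvature M.metric p u v = curvature M'.metric p u v := by
  refine ⟨fun hiso p hp u v => ?_, fun h => quotIso_of_polarCurvature_eq hZ hZc fun p hp v u => ?_⟩
  · rw [M.curvature_metric (hZ.subset_interior hp), M'.curvature_metric (hZ.subset_interior hp)]
    exact polarCurvature_eq_of_quotIso hZ hiso hp v u
  · rw [← M.curvature_metric (hZ.subset_interior hp), ← M'.curvature_metric (hZ.subset_interior hp)]
    exact h p hp u v

end QuasiFree

end Invariants

theorem theorem2_general {m : ℕ} {Ω Z : Set (EuclideanSpace ℂ (Fin m))}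
    (hZ : IsHypersurface Ω Z) (hZc : IsConnected Z)
    {H H' : Type*} [NormedAddCommGroup H] [InnerProductSpace ℂ H] [CompleteSpace H]
    [NormedAddCommGroup H'] [InnerProductSpace ℂ H'] [CompleteSpace H']
    (M : QuasiFree Ω H) (M' : QuasiFree Ω H')
    (ν : EuclideanSpace ℂ (Fin m) → EuclideanSpace ℂ (Fin m) → EuclideanSpace ℂ (Fin m))
    (hν : ∀ p ∈ Z, AnalyticAt ℂ (ν p) p ∧ ν p p ∉ tangentZ Ω Z p) :
    (M.QuotIso M' Z ↔ ∀ p ∈ Z,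
      curvTan Ω Z M.metric p = curvTan Ω Z M'.metric p ∧
      curvTrans M.metric p (ν p p) = curvTrans M'.metric p (ν p p) ∧
      curvOff Ω Z M.metric p (ν p p) = curvOff Ω Z M'.metric p (ν p p)) ∧
    (M.QuotIso M' Z ↔ ∀ p ∈ Z,
      curvTan Ω Z M.metric p = curvTan Ω Z M'.metric p ∧
      curvTrans M.metric p (ν p p) = curvTrans M'.metric p (ν p p) ∧
      secondFundamentalForm (ν p) M.metric p = secondFundamentalForm (ν p) M'.metric p) := by
  have hcurv : ∀ p ∈ Z, _ := fun p hp =>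
    QuasiFree.curvature_metric_eq_iff (M := M) (M' := M') hZ hp (hν p hp).2
  refine ⟨(QuasiFree.quotIso_iff_curvature_eq hZ hZc).trans (forall₂_congr hcurv),
    (QuasiFree.quotIso_iff_curvature_eq hZ hZc).trans (forall₂_congr fun p hp => ?_)⟩
  have hν0 : ν p p ≠ 0 := fun h => (hν p hp).2 (h ▸ zero_mem _)
  have hII := QuasiFree.secondFundamentalForm_metric_eq_iff (M := M) (M' := M')
    (hZ.subset_interior hp) (hν p hp).1 hν0
  refine ⟨fun h => ?_, fun ⟨htan, htrans, hforms⟩ => ?_⟩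
  · obtain ⟨htan, htrans, -⟩ := (hcurv p hp).mp h
    exact ⟨htan, htrans, (hII htrans).mpr (h _)⟩
  · exact (hcurv p hp).mpr ⟨htan, htrans, funext fun v => (hII htrans).mp hforms v⟩

theorem theorem2 {m : ℕ} {Ω Z : Set (EuclideanSpace ℂ (Fin m))}
    (hΩ : IsOpen Ω) (hΩc : IsConnected Ω) (hΩb : Bornology.IsBounded Ω)
    (hZ : IsHypersurface Ω Z) (hZc : IsConnected Z)
    {H H' : Type*} [NormedAddCommGroup H] [InnerProductSpace ℂ H] [CompleteSpace H]
    [NormedAddCommGroup H'] [InnerProductSpace ℂ H'] [CompleteSpace H']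
    (M : QuasiFree Ω H) (M' : QuasiFree Ω H')
    -- near each `p ∈ Z`, a holomorphic vector field `ν p` transverse to `Z`
    (ν : EuclideanSpace ℂ (Fin m) → EuclideanSpace ℂ (Fin m) → EuclideanSpace ℂ (Fin m))
    (hν : ∀ p ∈ Z, AnalyticAt ℂ (ν p) p ∧ ν p p ∉ tangentZ Ω Z p) :
    (M.QuotIso M' Z ↔ ∀ p ∈ Z,
      curvTan Ω Z M.metric p = curvTan Ω Z M'.metric p ∧
      curvTrans M.metric p (ν p p) = curvTrans M'.metric p (ν p p) ∧
      curvOff Ω Z M.metric p (ν p p) = curvOff Ω Z M'.metric p (ν p p)) ∧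
    (M.QuotIso M' Z ↔ ∀ p ∈ Z,
      curvTan Ω Z M.metric p = curvTan Ω Z M'.metric p ∧
      curvTrans M.metric p (ν p p) = curvTrans M'.metric p (ν p p) ∧
      secondFundamentalForm (ν p) M.metric p = secondFundamentalForm (ν p) M'.metric p) := by
  exact theorem2_general hZ hZc M M' ν hν
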